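/- Let $d,N\ge 1$. Let $|\cdot|$ denote the Euclidean (Frobenius) norm, $\mathbb S^{N-1}$ the unit sphere of $\mathbb R^N$, and $Q=(-\tfrac12,\tfrac12)^N$. Let $W\colon\mathbb R^{d\times N}\to[0,\infty)$ and $\psi\colon\mathbb R^d\times\mathbb S^{N-1}\to[0,\infty)$ be continuous functions such that, for some constants $c_W,C_W,c_\psi,C_\psi,c>0$ and $\alpha\in(0,1)$, and for all $A\in\mathbb R^{d\times N}$, $\lambda,\lambda_1,\lambda_2\in\mathbb R^d$, $\nu\in\mathbb S^{N-1}$: - $c_W|A|\le W(A)\le C_W(1+|A|)$, and $W$ is globally Lipschitz; - $\big|W^\infty(A)-\frac{W(tA)}{t}\big|\le \frac{c|A|^{1-\alpha}}{t^\alpha}$ whenever $t>0$ and $t|A|\ge1$, where $W^\infty(A)=\limsup_{t\to+\infty}\frac{W(tA)}{t}$; - $c_\psi|\lambda|\le\psi(\lambda,\nu)\le C_\psi|\lambda|$; - $\psi(t\lambda,\nu)=t\,\psi(\lambda,\nu)$ for all $t>0$, and $\psi(-\lambda,-\nu)=\psi(\lambda,\nu)$; - $\psi(\lambda_1+\lambda_2,\nu)\le\psi(\lambda_1,\nu)+\psi(\lambda_2,\nu)$.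 For $A,B\in\mathbb R^{d\times N}$ define $$H(A,B)=\inf\Big\{\int_Q W(\nabla u)\,dx+\int_{Q\cap S_u}\psi([u],\nu_u)\,d\mathcal H^{N-1}\ :\ u\in SBV(Q;\mathbb R^d),\ u=Ax \text{ on }\partial Q \text{ in the sense of traces},\ \int_Q\nabla u\,dx=B\Big\},$$ where $\nabla u$ is the density of the absolutely continuous part of $Du$, and $S_u$, $[u]$, $\nu_u$ are the jump set, the jump and the jump normal of $u$. Then $W$ has a minimizer on $\mathbb R^{d\times N}$, and $\psi$ has a minimizer on $\{(\xi,\nu)\in\mathbb R^d\times\mathbb R^N:|\xi|=|\nu|=1\}$. For every minimizer $B_0$ of $W$ and every minimizer $(\xi,\nu)$ of $\psi$ on this set, $$H(B_0+t\,\xi\otimes\nu,\,B_0)=W(B_0)+\psi(t\xi,\nu)\qquad\text{for all } t>0 .$$ Put $H_0(A,B)=\sqrt{|A|^2+1}+|B|$. For the same $B_0,\xi,\nu$, the function $(0,\infty)\ni t\mapsto H_0(B_0+t\,\xi\otimes\nu,B_0)$ is not affine. The function $H_0$ is quasiconvex-convex, that is, $$\int_Q H_0(A+\nabla v,B+w)\,dx\ge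 H_0(A,B)$$ for all $A,B\in\mathbb R^{d\times N}$, $v\in W^{1,\infty}_0(Q;\mathbb R^d)$ and $w\in L^\infty(Q;\mathbb R^{d\times N})$ with $\int_Q w\,dx=0$. Consequently $H\ne H_0$: for no choice of $W$ and $\psi$ as above is $H$ equal to $H_0$, so not every quasiconvex-convex function arises as such an $H$. -/

import Mathlib

open MeasureTheory Set Filter Topology
open scoped ENNReal NNReal ContDiff

-- Matrices carry the Euclidean (Frobenius) norm.
attribute [local instance] Matrix.frobeniusNormedAddCommGroup Matrix.frobeniusNormedSpace

noncomputable section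

namespace StructuredDeformation

/-- `ℝⁿ` with its Euclidean norm. -/
abbrev E (n : ℕ) : Type := EuclideanSpace ℝ (Fin n)

/-- The tensor product `ξ ⊗ ν = ξ νᵀ`. -/
def tensor {d N : ℕ} (ξ : E d) (ν : E N) : Matrix (Fin d) (Fin N) ℝ :=
  Matrix.of fun i j => ξ i * ν j

/-- The linear map `x ↦ A x`. -/
def linMap {d N : ℕ} (A : Matrix (Fin d) (Fin N) ℝ) (x : E N) : E d :=
  WithLp.toLp 2 (A.mulVec x.ofLp)

/-- The partial derivative `∂ⱼ φ (x)`. -/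
def pderiv {N : ℕ} (φ : E N → ℝ) (j : Fin N) (x : E N) : ℝ :=
  fderiv ℝ φ x (EuclideanSpace.single j (1 : ℝ))

/-! ### Hypotheses on the energy densities -/

/-- The recession function `W^∞(A) = limsup_{t → +∞} W(tA)/t`. -/
def recession {d N : ℕ} (W : Matrix (Fin d) (Fin N) ℝ → ℝ) (A : Matrix (Fin d) (Fin N) ℝ) : ℝ :=
  limsup (fun t : ℝ => W (t • A) / t) atTop

/-- The structural assumptions on the bulk density `W : ℝ^{d×N} → [0,∞)`. -/
structure AdmissibleBulk {d N : ℕ} (W : Matrix (Fin d) (Fin N) ℝ → ℝ) : Prop where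
  nonneg : ∀ A, 0 ≤ W A
  growth : ∃ c C : ℝ, 0 < c ∧ 0 < C ∧ ∀ A, c * ‖A‖ ≤ W A ∧ W A ≤ C * (1 + ‖A‖)
  lipschitz : ∃ K : ℝ≥0, LipschitzWith K W
  recession_rate : ∃ c α : ℝ, 0 < c ∧ 0 < α ∧ α < 1 ∧
    ∀ (A : Matrix (Fin d) (Fin N) ℝ) (t : ℝ), 0 < t → 1 ≤ t * ‖A‖ →
      |recession W A - W (t • A) / t| ≤ c * ‖A‖ ^ (1 - α) / t ^ α

/-- The structural assumptions on the surface density `ψ : ℝ^d × S^{N-1} → [0,∞)`. Only the values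
`ψ λ ν` with `‖ν‖ = 1` matter. -/
structure AdmissibleSurface {d N : ℕ} (ψ : E d → E N → ℝ) : Prop where
  nonneg : ∀ l ν, ‖ν‖ = 1 → 0 ≤ ψ l ν
  continuousOn : ContinuousOn (fun p : E d × E N => ψ p.1 p.2) (univ ×ˢ Metric.sphere 0 1)
  growth : ∃ c C : ℝ, 0 < c ∧ 0 < C ∧
    ∀ l ν, ‖ν‖ = 1 → c * ‖l‖ ≤ ψ l ν ∧ ψ l ν ≤ C * ‖l‖
  homogeneous : ∀ (t : ℝ) l ν, 0 < t → ‖ν‖ = 1 → ψ (t • l) ν = t * ψ l ν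
  symmetric : ∀ l ν, ‖ν‖ = 1 → ψ (-l) (-ν) = ψ l ν
  subadditive : ∀ l₁ l₂ ν, ‖ν‖ = 1 → ψ (l₁ + l₂) ν ≤ ψ l₁ ν + ψ l₂ ν

/-! ### Jump sets -/

/-- The half ball `{y ∈ B_r(x) : (y - x) · ν > 0}`. -/
def halfBall {N : ℕ} (x : E N) (r : ℝ) (ν : E N) : Set (E N) :=
  {y | y ∈ Metric.ball x r ∧ 0 < inner ℝ (y - x) ν}

/-- `x` is an approximate jump point of `u` with one-sided approximate limits `a ≠ b`, where `a` is
attained on the side of `x` to which the unit vector `ν` points, and `b` on the other side. -/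
structure IsJumpPoint {d N : ℕ} (u : E N → E d) (x : E N) (a b : E d) (ν : E N) : Prop where
  ne : a ≠ b
  unit : ‖ν‖ = 1
  lim_pos : Tendsto (fun r : ℝ => ⨍ y in halfBall x r ν, ‖u y - a‖) (𝓝[>] 0) (𝓝 0)
  lim_neg : Tendsto (fun r : ℝ => ⨍ y in halfBall x r (-ν), ‖u y - b‖) (𝓝[>] 0) (𝓝 0)

/-- The jump set `S_u` of `u` in `Ω`. -/
def jumpSet {d N : ℕ} (Ω : Set (E N)) (u : E N → E d) : Set (E N) :=
  {x | x ∈ Ω ∧ ∃ a b ν, IsJumpPoint u x a b ν}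

open Classical in
/-- A triple `(u⁺, u⁻, ν_u)` at a jump point `x`. It is unique up to replacing it by
`(u⁻, u⁺, -ν_u)`, which affects neither `[u] ⊗ ν_u` nor `ψ([u], ν_u)`. -/
def jumpTriple {d N : ℕ} (u : E N → E d) (x : E N) : E d × E d × E N :=
  if h : ∃ p : E d × E d × E N, IsJumpPoint u x p.1 p.2.1 p.2.2 then h.choose else 0

/-- The jump `[u] = u⁺ - u⁻`. -/
def jump {d N : ℕ} (u : E N → E d) (x : E N) : E d :=
  (jumpTriple u x).1 - (jumpTriple u x).2.1

/-- The jump normal `ν_u`. -/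
def jumpNormal {d N : ℕ} (u : E N → E d) (x : E N) : E N :=
  (jumpTriple u x).2.2

/-! ### Special functions of bounded variation

`μHE[N - 1]` is the `(N-1)`-dimensional Hausdorff measure `ℋ^{N-1}`, normalized to agree with
Lebesgue measure on hyperplanes. -/

/-- The integral `∫ φ dμᵢⱼ` of `φ` against the `(i,j)` entry of the matrix-valued measure
`μ = G 𝓛^N⌞Ω + [u] ⊗ ν_u ℋ^{N-1}⌞S_u`. -/
def derivPairing {d N : ℕ} (Ω : Set (E N)) (u : E N → E d)
    (G : E N → Matrix (Fin d) (Fin N) ℝ) (φ : E N → ℝ) (i : Fin d) (j : Fin N) : ℝ :=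
  (∫ x in Ω, φ x * G x i j) +
    ∫ x in jumpSet Ω u, φ x * tensor (jump u x) (jumpNormal u x) i j ∂μHE[N - 1]

/-- `u ∈ SBV(Ω; ℝ^d)` with approximate gradient `∇u = G`: the function `u` is integrable, and its
distributional derivative is the finite matrix-valued measure
`Du = G 𝓛^N + [u] ⊗ ν_u ℋ^{N-1}⌞S_u`
(in particular `u ∈ BV`, there is no Cantor part, and `G` is the density of the absolutely
continuous part of `Du`). -/
structure IsSBVWithGradient {d N : ℕ} (Ω : Set (E N)) (u : E N → E d)
    (G : E N → Matrix (Fin d) (Fin N) ℝ) : Prop where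
  integrable : IntegrableOn u Ω
  integrable_grad : ∀ i j, IntegrableOn (fun x => G x i j) Ω
  integrable_jump : ∀ i j, IntegrableOn
    (fun x => tensor (jump u x) (jumpNormal u x) i j) (jumpSet Ω u) μHE[N - 1]
  deriv_eq : ∀ φ : E N → ℝ, ContDiff ℝ ∞ φ → HasCompactSupport φ → tsupport φ ⊆ Ω →
    ∀ i j, ∫ x in Ω, u x i * pderiv φ j x = - derivPairing Ω u G φ i j

/-- `u ∈ SBV(Ω; ℝ^d)`, for open `Ω ⊆ ℝ^N`. -/
def IsSBV {d N : ℕ} (Ω : Set (E N)) (u : E N → E d) : Prop :=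
  ∃ G, IsSBVWithGradient Ω u G

open Classical in
/-- The density `∇u` of the absolutely continuous part of `Du`, for `u ∈ SBV(Ω; ℝ^d)`. It is unique
up to equality almost everywhere in `Ω`. -/
def grad {d N : ℕ} (Ω : Set (E N)) (u : E N → E d) : E N → Matrix (Fin d) (Fin N) ℝ :=
  if h : IsSBV Ω u then h.choose else 0

/-- The energy `E(u; Ω) = ∫_Ω W(∇u) dx + ∫_{Ω ∩ S_u} ψ([u], ν_u) dℋ^{N-1}`. -/
def energy {d N : ℕ} (W : Matrix (Fin d) (Fin N) ℝ → ℝ) (ψ : E d → E N → ℝ)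
    (Ω : Set (E N)) (u : E N → E d) : ℝ≥0∞ :=
  (∫⁻ x in Ω, ENNReal.ofReal (W (grad Ω u x))) +
    ∫⁻ x in jumpSet Ω u, ENNReal.ofReal (ψ (jump u x) (jumpNormal u x)) ∂μHE[N - 1]

/-! ### The unit cube, traces, and the relaxed bulk density -/

/-- The open unit cube `Q = (-1/2, 1/2)^N`. -/
def cube (N : ℕ) : Set (E N) := {x | ∀ i, |x i| < 1 / 2}

/-- The outer unit normal of `Q` at a boundary point lying on a single face; the points of `∂Q`
lying on two or more faces form an `ℋ^{N-1}`-null set. -/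
def cubeNormal {N : ℕ} (x : E N) (j : Fin N) : ℝ :=
  if x j = 1 / 2 then 1 else if x j = -(1 / 2) then -1 else 0

/-- `g ∈ L¹(∂Q; ℝ^d)` is the trace on `∂Q` of `u ∈ SBV(Q; ℝ^d)`, as characterized (uniquely up to
`ℋ^{N-1}`-null sets) by the Gauss–Green formula
`∫_Q uᵢ ∂ⱼφ dx = - ∫_Q φ d(Du)ᵢⱼ + ∫_{∂Q} φ gᵢ nⱼ dℋ^{N-1}` for all `φ ∈ C_c^∞(ℝ^N)`. -/
def HasTrace {d N : ℕ} (u g : E N → E d) : Prop :=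
  IntegrableOn g (frontier (cube N)) μHE[N - 1] ∧
  ∀ φ : E N → ℝ, ContDiff ℝ ∞ φ → HasCompactSupport φ → ∀ i j,
    ∫ x in cube N, u x i * pderiv φ j x =
      - derivPairing (cube N) u (grad (cube N) u) φ i j +
        ∫ x in frontier (cube N), φ x * g x i * cubeNormal x j ∂μHE[N - 1]

/-- The class of competitors `𝒞^bulk(A, B; Q)`: those `u ∈ SBV(Q; ℝ^d)` with `u = Ax` on `∂Q` and
`⨍_Q ∇u dx = B`. -/
def bulkCompetitors {d N : ℕ} (A B : Matrix (Fin d) (Fin N) ℝ) : Set (E N → E d) :=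
  {u | IsSBV (cube N) u ∧ HasTrace u (linMap A) ∧
    ∀ i j, ⨍ x in cube N, grad (cube N) u x i j = B i j}

/-- The relaxed bulk density `H(A, B) = inf {E(u; Q) : u ∈ 𝒞^bulk(A, B; Q)}`. -/
def relaxedBulk {d N : ℕ} (W : Matrix (Fin d) (Fin N) ℝ → ℝ) (ψ : E d → E N → ℝ)
    (A B : Matrix (Fin d) (Fin N) ℝ) : ℝ≥0∞ :=
  ⨅ u ∈ bulkCompetitors A B, energy W ψ (cube N) u

/-! ### Quasiconvex-convex functions -/

/-- The pointwise gradient matrix `(∂ⱼ vᵢ (x))ᵢⱼ`. -/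
def gradMatrix {d N : ℕ} (v : E N → E d) (x : E N) : Matrix (Fin d) (Fin N) ℝ :=
  Matrix.of fun i j => fderiv ℝ v x (EuclideanSpace.single j (1 : ℝ)) i

/-- `h` is quasiconvex-convex: `⨍_Q h(A + ∇v, B + w) dx ≥ h(A, B)` for all matrices `A`, `B`, all
`v ∈ W_0^{1,∞}(Q; ℝ^d)` (Lipschitz functions vanishing outside `Q`, differentiable a.e. by
Rademacher's theorem), and all `w ∈ L^∞(Q; ℝ^{d×N})` with `⨍_Q w dx = 0`. -/
def QuasiconvexConvex {d N : ℕ}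
    (h : Matrix (Fin d) (Fin N) ℝ → Matrix (Fin d) (Fin N) ℝ → ℝ) : Prop :=
  ∀ (A B : Matrix (Fin d) (Fin N) ℝ) (v : E N → E d) (w : E N → Matrix (Fin d) (Fin N) ℝ),
    (∃ K : ℝ≥0, LipschitzWith K v) → (∀ x, x ∉ cube N → v x = 0) →
    (∀ i j, MemLp (fun x => w x i j) ⊤ (volume.restrict (cube N))) →
    (∀ i j, ⨍ x in cube N, w x i j = 0) →
    IntegrableOn (fun x => h (A + gradMatrix v x) (B + w x)) (cube N) ∧
      h A B ≤ ⨍ x in cube N, h (A + gradMatrix v x) (B + w x)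

/-- The function `H₀(A, B) = √(|A|² + 1) + |B|`. -/
def H₀ {d N : ℕ} (A B : Matrix (Fin d) (Fin N) ℝ) : ℝ :=
  √(‖A‖ ^ 2 + 1) + ‖B‖

end StructuredDeformation

end

/-! Along the ray `A = B₀ + t ξ ⊗ ν` both terms of the energy can be minimized separately and almost
simultaneously, so `H` is affine in `t` there; `H₀` is strictly curved along the same ray.

Lower bound (`le_energy`). The bulk term is at least `W B₀`, as `Q` has measure one. Testing the
trace formula with a function equal to `1` near the closed cube shows that the total jump `∫ [u] ⊗
ν_u` equals `A - B₀ = t ξ ⊗ ν` for every competitor (`integral_tensor_jump`). Minimality and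
homogeneity give `ψ(λ, n) ≥ ψ(ξ, ν) |λ| ≥ ψ(ξ, ν) ⟨ξ, λ⟩ ⟨ν, n⟩`. The right side is linear in `λ ⊗
n`, hence acts as a calibration: integrated over the jump set it gives `t ψ(ξ, ν)`.

Upper bound (`exists_competitor_energy_le`). From `A x` subtract `τ η(x) s_ρ(x · ν) ξ`, where `s_ρ`
is a sawtooth of slope `1` and height `1/ρ`, and `η` is a cutoff supported in `Q` and equal to `1`
on most of it. The boundary values are unchanged. All jumps are positive multiples of `ξ` across
`ν`, up to orientation, so the surface energy is exactly `ψ(ξ, ν)` times the total jump. For large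
`ρ` the gradient is close to `B₀` where `η = 1`, and `τ` is tuned to make its mean exactly `B₀`. The
Lipschitz bound on `W` controls the rest.

That the competitor is in SBV with the stated gradient and trace is proved by hand: Fubini along `ν`
gives Gauss–Green on half spaces, the sawtooth is a linear function minus a staircase of half-space
indicators (`integral_sawtooth_mul_fderiv`), and `jumpSet` is identified through one-sided limits.

Finally, `H₀` is a sum of convex functions, so Jensen's inequality in its supporting-plane form
gives quasiconvexity-convexity. Were `H₀` affine on the ray, a quadratic polynomial would be a
perfect square, which contradicts Cauchy–Schwarz (`H₀_not_affine`). -/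

namespace StructuredDeformation

/-! ### Slicing along a direction -/

/-- The hyperplane `{x : x · ν = s}`. -/
def hyperplane {N : ℕ} (ν : E N) (s : ℝ) : Set (E N) := {x | inner ℝ ν x = s}

/-- The point at height `y` above the point `z` of `ν^⊥`. -/
def slicePoint {N : ℕ} (ν : E N) (p : ℝ × (ℝ ∙ ν)ᗮ) : E N := p.1 • ν + p.2

section Slicing

variable {N : ℕ} {ν : E N}

lemma continuous_slicePoint : Continuous (slicePoint ν) := by
  unfold slicePoint; fun_prop

lemma contDiff_slicePoint : ContDiff ℝ 1 (slicePoint ν) :=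
  (contDiff_fst.smul contDiff_const).add ((ℝ ∙ ν)ᗮ.subtypeL.contDiff.comp contDiff_snd)

lemma inner_slicePoint (hν : ‖ν‖ = 1) (y : ℝ) (z : (ℝ ∙ ν)ᗮ) :
    inner ℝ ν (slicePoint ν (y, z)) = y := by
  have h : inner ℝ ν (z : E N) = 0 := Submodule.mem_orthogonal_singleton_iff_inner_right.1 z.2
  simp [slicePoint, inner_add_right, inner_smul_right, h, hν]

lemma finrank_orthogonal_unit (hν : ‖ν‖ = 1) : Module.finrank ℝ (ℝ ∙ ν)ᗮ = N - 1 := by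
  have hν0 : ν ≠ 0 := by rintro rfl; simp at hν
  have h := (ℝ ∙ ν).finrank_add_finrank_orthogonal
  rw [finrank_span_singleton hν0, finrank_euclideanSpace_fin] at h
  omega

lemma measurableEmbedding_slicePoint (hν : ‖ν‖ = 1) : MeasurableEmbedding (slicePoint ν) := by
  apply continuous_slicePoint.measurableEmbedding
  rintro ⟨y, z⟩ ⟨y', z'⟩ h
  have hy : y = y' := by rw [← inner_slicePoint hν y z, h, inner_slicePoint hν]
  subst hy
  simpa [slicePoint] using h

/-- Lebesgue measure is a product over the orthogonal splitting `ℝν ⊕ ν^⊥`, and `y ↦ y ν` is an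
isometry of `ℝ` onto the first factor. -/
lemma measurePreserving_slicePoint (hν : ‖ν‖ = 1) : MeasurePreserving (slicePoint ν) := by
  have hν0 : ν ≠ 0 := by rintro rfl; simp at hν
  have h1 : MeasurePreserving (fun y : ℝ => (⟨y • ν, Submodule.mem_span_singleton.2 ⟨y, rfl⟩⟩ :
      ℝ ∙ ν)) := by
    exact (LinearIsometryEquiv.toSpanUnitSingleton ν hν).measurePreserving
  have h2 := (((ℝ ∙ ν).measurePreserving_measurableEquivProd (0 : E N)).symm).comp
    (h1.prod (MeasurePreserving.id (volume : Measure (ℝ ∙ ν)ᗮ)))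
  rw [InnerProductSpace.euclideanHausdorffMeasure_eq_volume] at h2
  have h3 : slicePoint ν = ⇑((ℝ ∙ ν).measurableEquivProd (0 : E N)).symm ∘
      Prod.map (fun y : ℝ => (⟨y • ν, Submodule.mem_span_singleton.2 ⟨y, rfl⟩⟩ : ℝ ∙ ν)) id := by
    ext1 p
    simp [slicePoint]
  rw [h3]
  exact h2

lemma isometry_slicePoint (s : ℝ) : Isometry fun z : (ℝ ∙ ν)ᗮ => slicePoint ν (s, z) :=
  Isometry.of_dist_eq fun z z' => by simp [slicePoint, Subtype.dist_eq]

lemma range_slicePoint (hν : ‖ν‖ = 1) (s : ℝ) :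
    range (fun z : (ℝ ∙ ν)ᗮ => slicePoint ν (s, z)) = hyperplane ν s := by
  ext x
  constructor
  · rintro ⟨z, rfl⟩
    exact inner_slicePoint hν s z
  · intro hx
    refine ⟨⟨x - s • ν, ?_⟩, by simp [slicePoint]⟩
    rw [Submodule.mem_orthogonal_singleton_iff_inner_right, inner_sub_right, inner_smul_right,
      real_inner_self_eq_norm_sq, hν, show inner ℝ ν x = s from hx]
    ring

lemma measurableSet_hyperplane (s : ℝ) : MeasurableSet (hyperplane ν s) :=
  (isClosed_eq (by fun_prop) continuous_const).measurableSet

/-- On a hyperplane, `ℋ^{N-1}` is the image of Lebesgue measure on `ν^⊥`. -/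
lemma restrict_hyperplane (hν : ‖ν‖ = 1) (s : ℝ) :
    (μHE[N - 1] : Measure (E N)).restrict (hyperplane ν s) =
      (volume : Measure (ℝ ∙ ν)ᗮ).map fun z => slicePoint ν (s, z) := by
  rw [← range_slicePoint hν, ← (isometry_slicePoint s).map_euclideanHausdorffMeasure,
    ← finrank_orthogonal_unit hν, InnerProductSpace.euclideanHausdorffMeasure_eq_volume]

lemma integral_hyperplane (hν : ‖ν‖ = 1) (s : ℝ) (g : E N → ℝ) :
    ∫ x in hyperplane ν s, g x ∂μHE[N - 1] = ∫ z : (ℝ ∙ ν)ᗮ, g (slicePoint ν (s, z)) := by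
  rw [restrict_hyperplane hν,
    (isometry_slicePoint s).isClosedEmbedding.measurableEmbedding.integral_map]

lemma integrableOn_hyperplane_iff (hν : ‖ν‖ = 1) (s : ℝ) (g : E N → ℝ) :
    IntegrableOn g (hyperplane ν s) μHE[N - 1] ↔
      Integrable fun z : (ℝ ∙ ν)ᗮ => g (slicePoint ν (s, z)) := by
  rw [IntegrableOn, restrict_hyperplane hν,
    (isometry_slicePoint s).isClosedEmbedding.measurableEmbedding.integrable_map_iff]
  rfl

lemma integral_slice (hν : ‖ν‖ = 1) {g : E N → ℝ} (hg : Integrable g) :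
    ∫ x, g x = ∫ z : (ℝ ∙ ν)ᗮ, ∫ y : ℝ, g (slicePoint ν (y, z)) := by
  rw [← (measurePreserving_slicePoint hν).integral_comp (measurableEmbedding_slicePoint hν),
    Measure.volume_eq_prod, integral_prod_symm]
  exact ((measurePreserving_slicePoint hν).integrable_comp_emb
    (measurableEmbedding_slicePoint hν)).2 hg

/-- The opposite order from `integral_slice`: with the height outermost, the inner integral can
absorb derivatives tangent to `ν^⊥`. -/
lemma integral_slice' (hν : ‖ν‖ = 1) {g : E N → ℝ} (hg : Integrable g) :
    ∫ x, g x = ∫ y : ℝ, ∫ z : (ℝ ∙ ν)ᗮ, g (slicePoint ν (y, z)) := by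
  rw [← (measurePreserving_slicePoint hν).integral_comp (measurableEmbedding_slicePoint hν),
    Measure.volume_eq_prod, integral_prod]
  exact ((measurePreserving_slicePoint hν).integrable_comp_emb
    (measurableEmbedding_slicePoint hν)).2 hg

lemma isCompact_slice {K : Set (E N)} (hK : IsCompact K) (s : ℝ) :
    IsCompact {z : (ℝ ∙ ν)ᗮ | slicePoint ν (s, z) ∈ K} :=
  (isometry_slicePoint s).isClosedEmbedding.isCompact_preimage hK

lemma hyperplane_inter_lt_top (hν : ‖ν‖ = 1) (s : ℝ) {K : Set (E N)} (hK : IsCompact K) :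
    (μHE[N - 1] : Measure (E N)) (hyperplane ν s ∩ K) < ⊤ := by
  rw [inter_comm, ← Measure.restrict_apply hK.measurableSet, restrict_hyperplane hν,
    Measure.map_apply (isometry_slicePoint s).continuous.measurable hK.measurableSet]
  exact (isCompact_slice hK s).measure_lt_top

lemma hasCompactSupport_slice {θ : E N → ℝ} (hc : HasCompactSupport θ) (s : ℝ) :
    HasCompactSupport fun z : (ℝ ∙ ν)ᗮ => θ (slicePoint ν (s, z)) :=
  hc.comp_isClosedEmbedding (isometry_slicePoint s).isClosedEmbedding

lemma integrableOn_hyperplane (hν : ‖ν‖ = 1) (s : ℝ) {θ : E N → ℝ} (h : Continuous θ)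
    (hc : HasCompactSupport θ) : IntegrableOn θ (hyperplane ν s) μHE[N - 1] := by
  rw [integrableOn_hyperplane_iff hν]
  exact (h.comp (isometry_slicePoint s).continuous).integrable_of_hasCompactSupport
    (hasCompactSupport_slice hc s)

lemma hasFDerivAt_slice_orthogonal (s : ℝ) {θ : E N → ℝ} (h : ContDiff ℝ 1 θ) (z : (ℝ ∙ ν)ᗮ) :
    HasFDerivAt (fun z : (ℝ ∙ ν)ᗮ => θ (slicePoint ν (s, z)))
      ((fderiv ℝ θ (slicePoint ν (s, z))).comp (ℝ ∙ ν)ᗮ.subtypeL) z := by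
  have h1 : HasFDerivAt (fun z : (ℝ ∙ ν)ᗮ => slicePoint ν (s, z)) (ℝ ∙ ν)ᗮ.subtypeL z := by
    simpa [slicePoint] using ((ℝ ∙ ν)ᗮ.subtypeL.hasFDerivAt (x := z)).const_add (s • ν)
  exact ((h.differentiable (by simp)) _).hasFDerivAt.comp z h1

lemma hasDerivAt_slice {θ : E N → ℝ} (h : ContDiff ℝ 1 θ) (z : (ℝ ∙ ν)ᗮ) (y : ℝ) :
    HasDerivAt (fun y : ℝ => θ (slicePoint ν (y, z))) (fderiv ℝ θ (slicePoint ν (y, z)) ν) y := by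
  have h1 : HasDerivAt (fun y : ℝ => slicePoint ν (y, z)) ν y := by
    simpa [slicePoint] using ((hasDerivAt_id y).smul_const ν).add_const (z : E N)
  exact ((h.differentiable (by simp)) _).hasFDerivAt.comp_hasDerivAt y h1

/-- The integral over space of a directional derivative of a compactly supported function
vanishes. -/
lemma integral_fderiv_apply_eq_zero {V : Type*} [NormedAddCommGroup V] [NormedSpace ℝ V]
    [FiniteDimensional ℝ V] [MeasurableSpace V] [BorelSpace V] {μ : Measure V}
    [μ.IsAddHaarMeasure] {θ : V → ℝ} (h : ContDiff ℝ 1 θ) (hc : HasCompactSupport θ) (w : V) :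
    ∫ x, fderiv ℝ θ x w ∂μ = 0 := by
  have hd : Continuous fun x => fderiv ℝ θ x w :=
    (h.continuous_fderiv (by simp)).clm_apply continuous_const
  -- Integration by parts against the constant `1`; only the products have to be integrable.
  have h1 := integral_mul_fderiv_eq_neg_fderiv_mul_of_integrable (𝕜 := ℝ) (f := fun _ : V => 1)
    (g := θ) (v := w) (μ := μ) (by simp)
    (by simpa using hd.integrable_of_hasCompactSupport (hc.fderiv_apply (𝕜 := ℝ) w))
    (by simpa using h.continuous.integrable_of_hasCompactSupport hc)
    (fun _ _ => by fun_prop) (fun x _ => (h.differentiable (by simp)) x)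
  simpa using h1

/-- The Gauss–Green formula on a half space. -/
lemma integral_halfSpace_fderiv (hν : ‖ν‖ = 1) {θ : E N → ℝ} (h : ContDiff ℝ 1 θ)
    (hc : HasCompactSupport θ) (s : ℝ) (w : E N) :
    ∫ x in {x | s ≤ inner ℝ ν x}, fderiv ℝ θ x w =
      - (inner ℝ ν w * ∫ x in hyperplane ν s, θ x ∂μHE[N - 1]) := by
  have hcont (w : E N) : Continuous fun x => fderiv ℝ θ x w :=
    (h.continuous_fderiv (by simp)).clm_apply continuous_const
  have hint (w : E N) : Integrable fun x => fderiv ℝ θ x w :=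
    (hcont w).integrable_of_hasCompactSupport (hc.fderiv_apply (𝕜 := ℝ) w)
  have hm : MeasurableSet {x : E N | s ≤ inner ℝ ν x} :=
    (isClosed_le continuous_const (by fun_prop)).measurableSet
  -- Normal direction: the fundamental theorem of calculus on each line parallel to `ν`, starting at
  -- height `s`.
  have hpar : ∫ x in {x | s ≤ inner ℝ ν x}, fderiv ℝ θ x ν =
      - ∫ x in hyperplane ν s, θ x ∂μHE[N - 1] := by
    rw [← integral_indicator hm, integral_slice hν ((hint ν).indicator hm),
      integral_hyperplane hν, ← integral_neg]
    congr 1 with z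
    have h1 : (fun y : ℝ => {x : E N | s ≤ inner ℝ ν x}.indicator (fun x => fderiv ℝ θ x ν)
        (slicePoint ν (y, z))) = (Ici s).indicator fun y => fderiv ℝ θ (slicePoint ν (y, z)) ν := by
      ext y
      simp only [indicator, mem_ofPred_eq, inner_slicePoint hν, mem_Ici]
    have hemb : IsClosedEmbedding fun y : ℝ => slicePoint ν (y, z) :=
      (Isometry.of_dist_eq fun y y' => by
        simp [slicePoint, dist_eq_norm, ← sub_smul, norm_smul, hν]).isClosedEmbedding
    have hcs := hc.comp_isClosedEmbedding hemb
    rw [h1, integral_indicator measurableSet_Ici, integral_Ici_eq_integral_Ioi]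
    have := HasCompactSupport.integral_Ioi_deriv_eq (f := fun y : ℝ => θ (slicePoint ν (y, z)))
      (h.comp (contDiff_slicePoint.comp (contDiff_id.prodMk contDiff_const))) hcs s
    simpa only [fun y => (hasDerivAt_slice h z y).deriv] using this
  -- Tangential directions: the half space is a union of full slices, and on each the integral of
  -- the derivative vanishes.
  have hperp (v : E N) (hv : inner ℝ ν v = 0) :
      ∫ x in {x | s ≤ inner ℝ ν x}, fderiv ℝ θ x v = 0 := by
    rw [← integral_indicator hm, integral_slice' hν ((hint v).indicator hm)]
    refine integral_eq_zero_of_ae (Eventually.of_forall fun y => ?_)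
    by_cases hy : s ≤ y
    · simp only [indicator, mem_ofPred_eq, inner_slicePoint hν, hy, if_true]
      have hv' : v ∈ (ℝ ∙ ν)ᗮ := Submodule.mem_orthogonal_singleton_iff_inner_right.2 hv
      have := integral_fderiv_apply_eq_zero (μ := (volume : Measure (ℝ ∙ ν)ᗮ))
        (θ := fun z => θ (slicePoint ν (y, z)))
        (h.comp (contDiff_slicePoint.comp (contDiff_const.prodMk contDiff_id)))
        (hasCompactSupport_slice hc y) ⟨v, hv'⟩
      simp only [(hasFDerivAt_slice_orthogonal y h _).fderiv] at this
      exact this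
    · simp only [indicator, mem_ofPred_eq, inner_slicePoint hν, hy, if_false, integral_zero]
      rfl
  have hw : w = (inner ℝ ν w : ℝ) • ν + (w - (inner ℝ ν w : ℝ) • ν) := by abel
  have h0 : inner ℝ ν (w - (inner ℝ ν w : ℝ) • ν) = 0 := by
    rw [inner_sub_right, inner_smul_right, real_inner_self_eq_norm_sq, hν]; ring
  calc ∫ x in {x | s ≤ inner ℝ ν x}, fderiv ℝ θ x w
      = ∫ x in {x | s ≤ inner ℝ ν x}, ((inner ℝ ν w : ℝ) * fderiv ℝ θ x ν +
          fderiv ℝ θ x (w - (inner ℝ ν w : ℝ) • ν)) := by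
        congr 1 with x
        conv_lhs => rw [hw]
        simp
    _ = _ := by
        rw [integral_add ((hint ν).integrableOn.const_mul _) (hint _).integrableOn,
          integral_const_mul, hpar, hperp _ h0]
        ring

end Slicing

/-! ### The unit cube -/

section Cube

variable {N : ℕ}

/-- The closed unit cube. -/
def closedCube (N : ℕ) : Set (E N) := {x | ∀ i, |x i| ≤ 1 / 2}

lemma isOpen_cube : IsOpen (cube N) := by
  simp only [cube, ofPred_forall]
  exact isOpen_iInter_of_finite fun i => isOpen_lt (by fun_prop) continuous_const

lemma isClosed_closedCube : IsClosed (closedCube N) := by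
  simp only [closedCube, ofPred_forall]
  exact isClosed_iInter fun i => isClosed_le (by fun_prop) continuous_const

lemma cube_eq_preimage :
    cube N = EuclideanSpace.equiv (Fin N) ℝ ⁻¹' univ.pi fun _ => Ioo (-(1 / 2)) (1 / 2) := by
  ext x
  simp [cube, abs_lt]

lemma closedCube_eq_preimage :
    closedCube N = EuclideanSpace.equiv (Fin N) ℝ ⁻¹' univ.pi fun _ => Icc (-(1 / 2)) (1 / 2) := by
  ext x
  simp only [closedCube, mem_ofPred_eq, abs_le, mem_preimage, Set.mem_pi, mem_univ,
    true_imp_iff, mem_Icc]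
  rfl

lemma closure_cube : closure (cube N) = closedCube N := by
  rw [cube_eq_preimage, closedCube_eq_preimage]
  have := (EuclideanSpace.equiv (Fin N) ℝ).toHomeomorph.preimage_closure
    (univ.pi fun _ : Fin N => Ioo (-(1 / 2) : ℝ) (1 / 2))
  rw [closure_pi_set] at this
  simp only [closure_Ioo (show (-(1 / 2) : ℝ) ≠ 1 / 2 by norm_num)] at this
  exact this.symm

lemma frontier_cube : frontier (cube N) = closedCube N \ cube N := by
  rw [isOpen_cube.frontier_eq, closure_cube]

lemma isCompact_closedCube : IsCompact (closedCube N) := by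
  rw [closedCube_eq_preimage]
  exact (EuclideanSpace.equiv (Fin N) ℝ).toHomeomorph.isClosedEmbedding.isCompact_preimage
    (isCompact_univ_pi fun _ => isCompact_Icc)

lemma cube_subset_closedCube : cube N ⊆ closedCube N := fun _ hx i => (hx i).le

lemma volume_cube : volume (cube N) = 1 := by
  have h := (PiLp.volume_preserving_ofLp (Fin N)).measure_preimage
    (MeasurableSet.univ_pi fun _ : Fin N => measurableSet_Ioo (a := (-(1 / 2) : ℝ))
      (b := 1 / 2)).nullMeasurableSet
  rw [cube_eq_preimage]
  refine h.trans ?_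
  rw [volume_pi_pi]
  norm_num

instance : IsProbabilityMeasure ((volume : Measure (E N)).restrict (cube N)) :=
  ⟨by rw [Measure.restrict_apply_univ, volume_cube]⟩

lemma setAverage_cube (f : E N → ℝ) : ⨍ x in cube N, f x = ∫ x in cube N, f x := by
  rw [average_eq_integral]

lemma convex_cube : Convex ℝ (cube N) := by
  rw [cube_eq_preimage]
  exact (convex_pi fun _ _ => convex_Ioo _ _).affine_preimage
    (EuclideanSpace.equiv (Fin N) ℝ).toLinearMap.toAffineMap

lemma closedCube_ae_eq_cube : closedCube N =ᵐ[volume] cube N := by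
  rw [← closure_cube]
  exact closure_ae_eq_of_null_frontier (convex_cube.addHaar_frontier volume)

/-- The coordinate direction `e_j`. -/
noncomputable abbrev coordDir (j : Fin N) : E N := EuclideanSpace.single j (1 : ℝ)

lemma norm_coordDir (j : Fin N) : ‖coordDir j‖ = 1 := by simp

lemma mem_hyperplane_coordDir {j : Fin N} {s : ℝ} {x : E N} :
    x ∈ hyperplane (coordDir j) s ↔ x j = s := by
  simp [hyperplane, EuclideanSpace.inner_single_left]

lemma frontier_cube_inter_hyperplane (j : Fin N) {s : ℝ} (hs : |s| = 1 / 2) :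
    frontier (cube N) ∩ (hyperplane (coordDir j) s ∩ closedCube N) =
      hyperplane (coordDir j) s ∩ closedCube N := by
  refine inter_eq_right.2 fun x hx => ?_
  rw [frontier_cube]
  refine ⟨hx.2, fun h => ?_⟩
  have h1 := h j
  rw [mem_hyperplane_coordDir.1 hx.1, hs] at h1
  exact lt_irrefl _ h1

lemma frontier_cube_subset : frontier (cube N) ⊆
    ⋃ j, (hyperplane (coordDir j) (1 / 2) ∩ closedCube N) ∪
      (hyperplane (coordDir j) (-(1 / 2)) ∩ closedCube N) := by
  rw [frontier_cube]
  rintro x ⟨hx, hx'⟩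
  simp only [cube, mem_ofPred_eq, not_forall, not_lt] at hx'
  obtain ⟨j, hj⟩ := hx'
  have h : |x j| = 1 / 2 := le_antisymm (hx j) hj
  rw [mem_iUnion]
  refine ⟨j, ?_⟩
  rcases eq_or_eq_neg_of_abs_eq h with h | h
  · exact Or.inl ⟨mem_hyperplane_coordDir.2 h, hx⟩
  · exact Or.inr ⟨mem_hyperplane_coordDir.2 h, hx⟩

lemma frontier_cube_lt_top : (μHE[N - 1] : Measure (E N)) (frontier (cube N)) < ⊤ := by
  refine (measure_mono frontier_cube_subset).trans_lt
    ((measure_iUnion_le _).trans_lt ?_)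
  rw [tsum_fintype, ENNReal.sum_lt_top]
  exact fun j _ => measure_union_lt_top
    (hyperplane_inter_lt_top (norm_coordDir j) _ isCompact_closedCube)
    (hyperplane_inter_lt_top (norm_coordDir j) _ isCompact_closedCube)

lemma integrableOn_frontier_cube {G : Type*} [NormedAddCommGroup G] [SecondCountableTopology G]
    {g : E N → G} (hg : Continuous g) :
    IntegrableOn g (frontier (cube N)) μHE[N - 1] := by
  obtain ⟨C, hC⟩ := isCompact_closedCube.exists_bound_of_continuousOn (f := g) hg.continuousOn
  refine Measure.integrableOn_of_bounded (M := C) frontier_cube_lt_top.ne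
    hg.aestronglyMeasurable ?_
  refine (ae_restrict_iff' isClosed_frontier.measurableSet).2 (Eventually.of_forall fun x hx => ?_)
  rw [frontier_cube] at hx
  exact hC x hx.1

/-- `cubeNormal x j` depends only on the coordinate `x j`, so the integrand is a difference of two
face indicators at every boundary point, edges included. -/
lemma integral_frontier_cube_mul_normal {F : E N → ℝ} (hF : Continuous F) (j : Fin N) :
    ∫ x in frontier (cube N), F x * cubeNormal x j ∂μHE[N - 1] =
      (∫ x in hyperplane (coordDir j) (1 / 2), (closedCube N).indicator F x ∂μHE[N - 1]) -
        ∫ x in hyperplane (coordDir j) (-(1 / 2)), (closedCube N).indicator F x ∂μHE[N - 1] := by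
  have hm (s : ℝ) : MeasurableSet (hyperplane (coordDir j) s ∩ closedCube N) :=
    (measurableSet_hyperplane s).inter isClosed_closedCube.measurableSet
  have hI := integrableOn_frontier_cube hF
  have h1 : ∀ x ∈ frontier (cube N), F x * cubeNormal x j =
      (hyperplane (coordDir j) (1 / 2) ∩ closedCube N).indicator F x -
        (hyperplane (coordDir j) (-(1 / 2)) ∩ closedCube N).indicator F x := by
    intro x hx
    rw [frontier_cube] at hx
    have hx' := hx.1
    simp only [indicator, mem_inter_iff, mem_hyperplane_coordDir, hx', and_true, cubeNormal]
    split_ifs with h h'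
    · rw [h] at h'; norm_num at h'
    · ring
    · ring
    · ring
  rw [setIntegral_congr_fun isClosed_frontier.measurableSet h1,
    integral_sub (hI.indicator (hm _)) (hI.indicator (hm _)),
    setIntegral_indicator (hm _), setIntegral_indicator (hm _),
    frontier_cube_inter_hyperplane j (by norm_num),
    frontier_cube_inter_hyperplane j (by norm_num),
    setIntegral_indicator isClosed_closedCube.measurableSet,
    setIntegral_indicator isClosed_closedCube.measurableSet]

/-- The cube is the product of an interval along `e_j` with its section by `e_j^⊥`, so each line
parallel to `e_j` meets it in a full interval or not at all. -/
lemma slicePoint_mem_closedCube {j : Fin N} {y : ℝ} {z : (ℝ ∙ coordDir j)ᗮ} :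
    slicePoint (coordDir j) (y, z) ∈ closedCube N ↔
      y ∈ Icc (-(1 / 2)) (1 / 2) ∧ (z : E N) ∈ closedCube N := by
  have hz : (z : E N) j = 0 := by
    have := Submodule.mem_orthogonal_singleton_iff_inner_right.1 z.2
    simpa [EuclideanSpace.inner_single_left] using this
  rw [mem_Icc, ← abs_le]
  constructor
  · intro h
    have hj := h j
    simp only [slicePoint, PiLp.add_apply, PiLp.smul_apply, hz] at hj
    refine ⟨by simpa using hj, fun i => ?_⟩
    by_cases hi : i = j
    · subst hi; rw [hz]; norm_num
    · have := h i
      simpa [slicePoint, hi] using this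
  · rintro ⟨hy, h⟩ i
    by_cases hi : i = j
    · subst hi; simpa [slicePoint, hz] using hy
    · have := h i
      simpa [slicePoint, hi] using this

/-- The Gauss–Green formula on the unit cube. -/
lemma integral_cube_pderiv {F : E N → ℝ} (h : ContDiff ℝ 1 F) (hc : HasCompactSupport F)
    (j : Fin N) :
    ∫ x in cube N, pderiv F j x =
      ∫ x in frontier (cube N), F x * cubeNormal x j ∂μHE[N - 1] := by
  set ν : E N := coordDir j with hνdef
  have hν : ‖ν‖ = 1 := norm_coordDir j
  have hcont : Continuous (pderiv F j) :=
    (h.continuous_fderiv (by simp)).clm_apply continuous_const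
  have hint : Integrable (pderiv F j) :=
    hcont.integrable_of_hasCompactSupport (hc.fderiv_apply (𝕜 := ℝ) _)
  have hmK : MeasurableSet (closedCube N) := isClosed_closedCube.measurableSet
  have hI (s : ℝ) : Integrable fun z : (ℝ ∙ ν)ᗮ =>
      (closedCube N).indicator F (slicePoint ν (s, z)) :=
    ((integrableOn_hyperplane_iff hν s _).1
      ((integrableOn_hyperplane hν s h.continuous hc).indicator hmK))
  rw [integral_frontier_cube_mul_normal h.continuous, integral_hyperplane hν,
    integral_hyperplane hν, ← integral_sub (hI _) (hI _),
    ← setIntegral_congr_set closedCube_ae_eq_cube, ← integral_indicator hmK,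
    integral_slice hν (hint.indicator hmK)]
  congr 1 with z
  by_cases hz : (z : E N) ∈ closedCube N
  · have h1 : (fun y : ℝ => (closedCube N).indicator (pderiv F j) (slicePoint ν (y, z))) =
        (Icc (-(1 / 2)) (1 / 2)).indicator fun y => pderiv F j (slicePoint ν (y, z)) := by
      have hmem (y : ℝ) : slicePoint ν (y, z) ∈ closedCube N ↔ y ∈ Icc (-(1 / 2)) (1 / 2) :=
        slicePoint_mem_closedCube.trans (and_iff_left hz)
      ext y
      simp only [indicator, hmem]
    have h2 (s : ℝ) (hs : |s| ≤ 1 / 2) :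
        (closedCube N).indicator F (slicePoint ν (s, z)) = F (slicePoint ν (s, z)) :=
      indicator_of_mem (slicePoint_mem_closedCube.2 ⟨abs_le.1 hs, hz⟩) _
    rw [h1, integral_indicator measurableSet_Icc, integral_Icc_eq_integral_Ioc,
      ← intervalIntegral.integral_of_le (by norm_num), h2 _ (by norm_num), h2 _ (by norm_num)]
    refine intervalIntegral.integral_eq_sub_of_hasDerivAt
      (f := fun y => F (slicePoint ν (y, z))) (fun y _ => hasDerivAt_slice h z y) ?_
    exact (hcont.comp (continuous_slicePoint.comp (by fun_prop))).intervalIntegrable _ _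
  · have h2 (G : E N → ℝ) (s : ℝ) : (closedCube N).indicator G (slicePoint ν (s, z)) = 0 :=
      indicator_of_notMem (fun h => hz (slicePoint_mem_closedCube.1 h).2) _
    simp [h2]

end Cube

/-! ### Sawtooth functions -/

/-- The sawtooth function of slope `1` with jumps `-1/ρ` at the points of `ρ⁻¹ℤ`. -/
noncomputable def sawtooth (ρ y : ℝ) : ℝ := Int.fract (ρ * y) / ρ

/-- The union of the hyperplanes `x · ν = k/ρ`, `k ∈ ℤ`. -/
def sawtoothPlanes {N : ℕ} (ν : E N) (ρ : ℝ) : Set (E N) := {x | ∃ k : ℤ, ρ * inner ℝ ν x = k}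

lemma sawtooth_nonneg {ρ : ℝ} (hρ : 0 < ρ) (y : ℝ) : 0 ≤ sawtooth ρ y :=
  div_nonneg (Int.fract_nonneg _) hρ.le

lemma sawtooth_le {ρ : ℝ} (hρ : 0 < ρ) (y : ℝ) : sawtooth ρ y ≤ 1 / ρ :=
  div_le_div_of_nonneg_right (Int.fract_lt_one _).le hρ.le

lemma measurable_sawtooth (ρ : ℝ) : Measurable (sawtooth ρ) := by
  unfold sawtooth
  exact (measurable_fract.comp (measurable_const_mul ρ)).div_const ρ

/-- The sawtooth function is a linear function minus a staircase. -/
lemma sawtooth_eq {ρ : ℝ} (hρ : 0 < ρ) {M : ℕ} {y : ℝ} (hy : |ρ * y| < M) :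
    sawtooth ρ y = y - 1 / ρ *
      ((∑ k ∈ Finset.Ioc (-(M : ℤ)) M, (Ici (k / ρ : ℝ)).indicator 1 y) - M) := by
  have hlt := abs_lt.1 hy
  have h1 : ∀ k : ℤ, (Ici (k / ρ : ℝ)).indicator (1 : ℝ → ℝ) y = if k ≤ ⌊ρ * y⌋ then 1 else 0 := by
    intro k
    simp only [indicator, mem_Ici, div_le_iff₀ hρ, Int.le_floor, mul_comm ρ y, Pi.one_apply]
  -- The indicators equal to `1` are those with `-M < k ≤ ⌊ρ y⌋`. There are `⌊ρ y⌋ + M` of them,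
  -- which explains the correction `- M`.
  have h2 : (Finset.Ioc (-(M : ℤ)) M).filter (fun k => k ≤ ⌊ρ * y⌋) =
      Finset.Ioc (-(M : ℤ)) ⌊ρ * y⌋ := by
    have : ⌊ρ * y⌋ < M := Int.floor_lt.2 (by exact_mod_cast hlt.2)
    ext k
    simp only [Finset.mem_filter, Finset.mem_Ioc]
    omega
  have h3 : -(M : ℤ) ≤ ⌊ρ * y⌋ := Int.le_floor.2 (by push_cast; exact hlt.1.le)
  have h4 : (((⌊ρ * y⌋ - -(M : ℤ)).toNat : ℤ) : ℝ) = ⌊ρ * y⌋ + M := by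
    rw [Int.toNat_of_nonneg (by omega)]; push_cast; ring
  simp only [h1]
  rw [← Finset.sum_filter, h2, Finset.sum_const, Int.card_Ioc, nsmul_eq_mul, mul_one,
    ← Int.cast_natCast, h4, sawtooth, Int.fract]
  field_simp
  ring

section Planes

variable {N : ℕ} {ν : E N}

lemma measurableSet_sawtoothPlanes (ρ : ℝ) : MeasurableSet (sawtoothPlanes ν ρ) := by
  have : sawtoothPlanes ν ρ = ⋃ k : ℤ, {x : E N | ρ * inner ℝ ν x = k} := by
    ext x; simp [sawtoothPlanes]
  rw [this]
  exact MeasurableSet.iUnion fun k => (isClosed_eq (by fun_prop) continuous_const).measurableSet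

lemma hyperplane_subset_sawtoothPlanes {ρ : ℝ} (hρ : 0 < ρ) (k : ℤ) :
    hyperplane ν (k / ρ) ⊆ sawtoothPlanes ν ρ := by
  intro x hx
  refine ⟨k, ?_⟩
  rw [show inner ℝ ν x = k / ρ from hx]
  field_simp

/-- A compact support lies in a slab, so only the planes with index in `(-M, M]` matter and all sums
over planes are finite. -/
lemma exists_bound_of_hasCompactSupport (hν : ‖ν‖ = 1) {θ : E N → ℝ} (hc : HasCompactSupport θ)
    {ρ : ℝ} (hρ : 0 < ρ) : ∃ M : ℕ, ∀ x ∈ tsupport θ, |ρ * inner ℝ ν x| < M := by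
  obtain ⟨C, hC⟩ := hc.isCompact.isBounded.exists_norm_le
  obtain ⟨M, hM⟩ := exists_nat_gt (ρ * C)
  refine ⟨M, fun x hx => lt_of_le_of_lt ?_ hM⟩
  rw [abs_mul, abs_of_pos hρ]
  have := abs_real_inner_le_norm ν x
  rw [hν, one_mul] at this
  exact mul_le_mul_of_nonneg_left (this.trans (hC x hx)) hρ.le

lemma eq_zero_of_mem_sawtoothPlanes {θ : E N → ℝ} {ρ : ℝ} (hρ : 0 < ρ) {M : ℕ}
    (hM : ∀ x ∈ tsupport θ, |ρ * inner ℝ ν x| < M) {x : E N}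
    (hx : x ∈ sawtoothPlanes ν ρ \ ⋃ k ∈ Finset.Ioc (-(M : ℤ)) M, hyperplane ν (k / ρ)) :
    θ x = 0 := by
  by_contra h
  obtain ⟨⟨k, hk⟩, hx⟩ := hx
  have h1 := hM x (subset_tsupport _ h)
  rw [hk, abs_lt] at h1
  apply hx
  simp only [mem_iUnion]
  refine ⟨k, Finset.mem_Ioc.2 ⟨by exact_mod_cast h1.1, by exact_mod_cast h1.2.le⟩, ?_⟩
  show inner ℝ ν x = k / ρ
  rw [eq_div_iff hρ.ne', mul_comm, hk]

lemma integrableOn_sawtoothPlanes (hν : ‖ν‖ = 1) {θ : E N → ℝ} (h : Continuous θ)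
    (hc : HasCompactSupport θ) {ρ : ℝ} (hρ : 0 < ρ) :
    IntegrableOn θ (sawtoothPlanes ν ρ) μHE[N - 1] := by
  obtain ⟨M, hM⟩ := exists_bound_of_hasCompactSupport hν hc hρ
  refine IntegrableOn.of_forall_sdiff_eq_zero
    (s := ⋃ k ∈ Finset.Ioc (-(M : ℤ)) M, hyperplane ν (k / ρ)) ?_
    (measurableSet_sawtoothPlanes ρ) fun x hx => eq_zero_of_mem_sawtoothPlanes hρ hM hx
  exact integrableOn_finset_iUnion.2 fun k _ => integrableOn_hyperplane hν _ h hc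

lemma integral_sawtoothPlanes (hν : ‖ν‖ = 1) {θ : E N → ℝ} (h : Continuous θ)
    (hc : HasCompactSupport θ) {ρ : ℝ} (hρ : 0 < ρ) {M : ℕ}
    (hM : ∀ x ∈ tsupport θ, |ρ * inner ℝ ν x| < M) :
    ∫ x in sawtoothPlanes ν ρ, θ x ∂μHE[N - 1] =
      ∑ k ∈ Finset.Ioc (-(M : ℤ)) M, ∫ x in hyperplane ν (k / ρ), θ x ∂μHE[N - 1] := by
  rw [setIntegral_eq_of_subset_of_forall_sdiff_eq_zero (measurableSet_sawtoothPlanes ρ)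
    (iUnion₂_subset fun k (_ : k ∈ Finset.Ioc (-(M : ℤ)) M) =>
      hyperplane_subset_sawtoothPlanes hρ k) fun x hx => eq_zero_of_mem_sawtoothPlanes hρ hM hx]
  refine integral_biUnion_finset _ (fun k _ => measurableSet_hyperplane _) ?_
    fun k _ => integrableOn_hyperplane hν _ h hc
  intro k _ l _ hkl
  refine Set.disjoint_left.2 fun x hx hx' => hkl ?_
  have h1 : (k / ρ : ℝ) = l / ρ := (show inner ℝ ν x = _ from hx).symm.trans hx'
  exact_mod_cast (div_left_inj' hρ.ne').1 h1

/-- The distributional derivative of `x ↦ f (x · ν)`, for a sawtooth function `f`. -/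
lemma integral_sawtooth_mul_fderiv (hν : ‖ν‖ = 1) {θ : E N → ℝ} (h : ContDiff ℝ 1 θ)
    (hc : HasCompactSupport θ) {ρ : ℝ} (hρ : 0 < ρ) (w : E N) :
    ∫ x, sawtooth ρ (inner ℝ ν x) * fderiv ℝ θ x w =
      inner ℝ ν w * (1 / ρ * (∫ x in sawtoothPlanes ν ρ, θ x ∂μHE[N - 1]) - ∫ x, θ x) := by
  obtain ⟨M, hM⟩ := exists_bound_of_hasCompactSupport hν hc hρ
  have hcd := hc.fderiv_apply (𝕜 := ℝ) w
  have hcont : Continuous fun x => fderiv ℝ θ x w :=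
    (h.continuous_fderiv (by simp)).clm_apply continuous_const
  have hint : Integrable fun x => fderiv ℝ θ x w := hcont.integrable_of_hasCompactSupport hcd
  have hintl : Integrable fun x => inner ℝ ν x * fderiv ℝ θ x w :=
    (Continuous.mul (by fun_prop) hcont).integrable_of_hasCompactSupport hcd.mul_left
  have hm (s : ℝ) : MeasurableSet {x : E N | s ≤ inner ℝ ν x} :=
    (isClosed_le continuous_const (by fun_prop)).measurableSet
  have hlin : ∫ x, inner ℝ ν x * fderiv ℝ θ x w = - (inner ℝ ν w * ∫ x, θ x) := by
    have hd (x : E N) : HasFDerivAt (fun x : E N => inner ℝ ν x) (innerSL ℝ ν) x :=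
      (innerSL ℝ ν).hasFDerivAt
    rw [integral_mul_fderiv_eq_neg_fderiv_mul_of_integrable (𝕜 := ℝ)
      (f := fun x : E N => inner ℝ ν x) (g := θ) ?_ hintl ?_ (fun x _ => (hd x).differentiableAt)
      (fun x _ => h.differentiable (by simp) x)]
    · simp only [(hd _).fderiv, innerSL_apply_apply, integral_const_mul]
    · simp only [(hd _).fderiv, innerSL_apply_apply]
      exact (h.continuous.integrable_of_hasCompactSupport hc).const_mul _
    · exact (Continuous.mul (by fun_prop) h.continuous).integrable_of_hasCompactSupport hc.mul_left
  -- `sawtooth_eq` is available only inside the slab; off the support of `θ` both sides vanish.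
  have hpt (x : E N) : sawtooth ρ (inner ℝ ν x) * fderiv ℝ θ x w =
      inner ℝ ν x * fderiv ℝ θ x w - 1 / ρ * ((∑ k ∈ Finset.Ioc (-(M : ℤ)) M,
        {x : E N | k / ρ ≤ inner ℝ ν x}.indicator (fun x => fderiv ℝ θ x w) x) -
          M * fderiv ℝ θ x w) := by
    by_cases hx : x ∈ tsupport θ
    · have h1 (k : ℤ) : {x : E N | k / ρ ≤ inner ℝ ν x}.indicator (fun x => fderiv ℝ θ x w) x =
          (Ici (k / ρ : ℝ)).indicator 1 (inner ℝ ν x) * fderiv ℝ θ x w := by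
        simp only [indicator, mem_ofPred_eq, mem_Ici, Pi.one_apply]
        split_ifs <;> simp
      simp only [h1]
      rw [sawtooth_eq hρ (hM x hx), ← Finset.sum_mul]
      ring
    · have h0 : fderiv ℝ θ x = 0 := by
        by_contra h0
        exact hx (support_fderiv_subset ℝ h0)
      simp [indicator, h0]
  have hsum : Integrable fun x => ∑ k ∈ Finset.Ioc (-(M : ℤ)) M,
      {x : E N | k / ρ ≤ inner ℝ ν x}.indicator (fun x => fderiv ℝ θ x w) x :=
    integrable_finsetSum _ fun k _ => hint.indicator (hm _)
  have hdiff : Integrable fun x => (∑ k ∈ Finset.Ioc (-(M : ℤ)) M,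
      {x : E N | k / ρ ≤ inner ℝ ν x}.indicator (fun x => fderiv ℝ θ x w) x) -
        M * fderiv ℝ θ x w := hsum.sub (hint.const_mul _)
  simp only [hpt]
  rw [integral_sub hintl (hdiff.const_mul _), integral_const_mul,
    integral_sub hsum (hint.const_mul _), integral_const_mul,
    integral_finsetSum _ fun k _ => hint.indicator (hm _), hlin,
    integral_fderiv_apply_eq_zero h hc, integral_sawtoothPlanes hν h.continuous hc hρ hM]
  simp only [integral_indicator (hm _), integral_halfSpace_fderiv hν h hc]
  -- Each half space has contributed minus its plane integral, and the constant `M` has dropped out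
  -- since `∂_w θ` integrates to zero.
  rw [Finset.sum_neg_distrib, ← Finset.mul_sum]
  ring

end Planes

/-! ### One-sided limits and jump points -/

section Jump

variable {d N : ℕ} {u : E N → E d} {x : E N} {a b a₀ b₀ : E d} {ν ν' : E N}

/-- `u` tends to `a` at `x` from the side of `x` to which `ν` points. -/
def SidedLimit (u : E N → E d) (x : E N) (ν : E N) (a : E d) : Prop :=
  Tendsto u (𝓝[{y | 0 < inner ℝ (y - x) ν}] x) (𝓝 a)

lemma SidedLimit.eventually_halfBall (h : SidedLimit u x ν a) {ε : ℝ} (hε : 0 < ε) :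
    ∀ᶠ r in 𝓝[>] (0 : ℝ), ∀ y ∈ halfBall x r ν, ‖u y - a‖ ≤ ε := by
  have h1 : ∀ᶠ y in 𝓝[{y | 0 < inner ℝ (y - x) ν}] x, dist (u y) a < ε :=
    h (Metric.ball_mem_nhds a hε)
  obtain ⟨δ, hδ, h2⟩ := Metric.mem_nhdsWithin_iff.1 h1
  filter_upwards [mem_nhdsWithin_of_mem_nhds (Iio_mem_nhds hδ)] with r hr y hy
  rw [← dist_eq_norm]
  exact le_of_lt (h2 ⟨Metric.ball_subset_ball (le_of_lt hr) hy.1, hy.2⟩)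

lemma halfBall_subset_ball (r : ℝ) : halfBall x r ν ⊆ Metric.ball x r := fun _ h => h.1

lemma isOpen_halfBall (r : ℝ) : IsOpen (halfBall x r ν) :=
  Metric.isOpen_ball.inter (isOpen_lt (f := fun _ : E N => (0 : ℝ))
    (g := fun y : E N => inner ℝ (y - x) ν)
    continuous_const (by fun_prop))

lemma volume_halfBall_lt_top (r : ℝ) : volume (halfBall x r ν) < ⊤ :=
  (measure_mono (halfBall_subset_ball r)).trans_lt measure_ball_lt_top

lemma SidedLimit.tendsto_average (h : SidedLimit u x ν a) :
    Tendsto (fun r : ℝ => ⨍ y in halfBall x r ν, ‖u y - a‖) (𝓝[>] 0) (𝓝 0) := by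
  rw [Metric.tendsto_nhds]
  intro ε hε
  filter_upwards [h.eventually_halfBall (half_pos hε)] with r hr
  have h1 := norm_setIntegral_le_of_norm_le_const (f := fun y => ‖u y - a‖) (C := ε / 2)
    (volume_halfBall_lt_top (x := x) (ν := ν) r) (fun y hy => by simpa using hr y hy)
  rw [dist_zero_right, setAverage_eq, norm_smul, norm_inv, Real.norm_of_nonneg measureReal_nonneg]
  rcases (measureReal_nonneg (μ := volume) (s := halfBall x r ν)).eq_or_lt with h0 | h0
  · simp [← h0, hε]
  · rw [inv_mul_lt_iff₀ h0]
    refine h1.trans_lt ?_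
    rw [mul_comm]
    exact mul_lt_mul_of_pos_left (half_lt_self hε) h0

/-- Two half balls around `x` which are not opposite have an intersection of positive density. -/
lemma exists_volume_inter_ge (hν : ‖ν‖ = 1) (hν' : ‖ν'‖ = 1) (h : ν + ν' ≠ 0) :
    ∃ c : ℝ, 0 < c ∧ ∀ r : ℝ, 0 < r →
      c * volume.real (halfBall x r ν') ≤ volume.real (halfBall x r ν ∩ halfBall x r ν') := by
  -- `m` is the cosine of half the angle between `ν` and `ν'`, and `v` is the unit bisector, making
  -- the same inner product `m` with both.
  set m : ℝ := ‖ν + ν'‖ / 2 with hm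
  have hm0 : 0 < m := by have := norm_pos_iff.2 h; positivity
  have hm1 : m ≤ 1 := by
    have := norm_add_le ν ν'
    rw [hν, hν'] at this
    linarith
  set v : E N := (2 * m)⁻¹ • (ν + ν') with hv
  have hsq : inner ℝ (ν + ν') (ν + ν') = (2 * m) ^ 2 := by
    rw [real_inner_self_eq_norm_sq, hm]; ring
  have hin : inner ℝ ν ν' = 2 * m ^ 2 - 1 := by
    rw [real_inner_add_add_self, real_inner_self_eq_norm_sq, real_inner_self_eq_norm_sq, hν, hν']
      at hsq
    linarith
  have hvn : ‖v‖ = 1 := by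
    rw [hv, norm_smul, norm_inv, Real.norm_of_nonneg (by positivity), hm]
    field_simp
  have hvν : inner ℝ v ν = m := by
    rw [hv, inner_smul_left, inner_add_left, real_inner_self_eq_norm_sq, hν, real_inner_comm, hin]
    simp
    field_simp
  have hvν' : inner ℝ v ν' = m := by
    rw [hv, inner_smul_left, inner_add_left, real_inner_self_eq_norm_sq, hν', hin]
    simp
    field_simp
  refine ⟨(m / 2) ^ N, by positivity, fun r hr => ?_⟩
  -- This ball lies in both half spaces because its centre is at distance `m r / 2`, its radius,
  -- from both bounding planes; `m ≤ 1` keeps it inside `B_r(x)`. Its volume is `(m/2)^N` times that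
  -- of `B_r(x)`.
  have hsub : Metric.ball (x + (r / 2) • v) (m / 2 * r) ⊆ halfBall x r ν ∩ halfBall x r ν' := by
    intro y hy
    rw [Metric.mem_ball, dist_eq_norm] at hy
    set w := y - (x + (r / 2) • v) with hw
    have hyx : y - x = (r / 2) • v + w := by rw [hw]; abel
    have hball : y ∈ Metric.ball x r := by
      rw [Metric.mem_ball, dist_eq_norm, hyx]
      refine (norm_add_le _ _).trans_lt ?_
      rw [norm_smul, hvn, Real.norm_of_nonneg (by positivity)]
      nlinarith
    have hpos (n : E N) (hn : ‖n‖ = 1) (hvn : inner ℝ v n = m) : 0 < inner ℝ (y - x) n := by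
      have h1 := abs_real_inner_le_norm w n
      rw [hn, mul_one] at h1
      have h2 := (abs_le.1 h1).1
      rw [hyx, inner_add_left, inner_smul_left, hvn]
      simp only [conj_trivial]
      linarith
    exact ⟨⟨hball, hpos ν hν hvν⟩, ⟨hball, hpos ν' hν' hvν'⟩⟩
  have h1 : volume.real (halfBall x r ν') ≤ volume.real (Metric.ball x r) :=
    measureReal_mono (halfBall_subset_ball r) measure_ball_lt_top.ne
  have h2 : volume.real (Metric.ball (x + (r / 2) • v) (m / 2 * r)) ≤
      volume.real (halfBall x r ν ∩ halfBall x r ν') :=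
    measureReal_mono hsub
      ((measure_mono inter_subset_left).trans_lt (volume_halfBall_lt_top r)).ne
  have h3 (z : E N) {s : ℝ} (hs : 0 < s) :
      volume.real (Metric.ball z s) = s ^ N * volume.real (Metric.ball (0 : E N) 1) := by
    rw [measureReal_def, Measure.addHaar_ball_of_pos _ _ hs, ENNReal.toReal_mul,
      ENNReal.toReal_ofReal (by positivity), finrank_euclideanSpace_fin, measureReal_def]
  refine le_trans (mul_le_mul_of_nonneg_left h1 (by positivity)) (le_trans (le_of_eq ?_) h2)
  rw [h3 x hr, h3 (x + (r / 2) • v) (show 0 < m / 2 * r by positivity)]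
  ring

/-- If `a ≠ a₀`, then near `x` one has `|u - a| ≥ |a - a₀|/2` on the overlap of the two half balls.
The overlap fills a fixed fraction of the second one, so the average there cannot tend to zero. -/
lemma SidedLimit.eq_of_tendsto_average (h : SidedLimit u x ν a₀) (hu : LocallyIntegrable u)
    (hν : ‖ν‖ = 1) (hν' : ‖ν'‖ = 1) (hne : ν + ν' ≠ 0)
    (ha : Tendsto (fun r : ℝ => ⨍ y in halfBall x r ν', ‖u y - a‖) (𝓝[>] 0) (𝓝 0)) :
    a = a₀ := by
  by_contra hcon
  set δ := ‖a - a₀‖ with hδ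
  have hδ0 : 0 < δ := norm_pos_iff.2 (sub_ne_zero.2 hcon)
  obtain ⟨c, hc, hvol⟩ := exists_volume_inter_ge (x := x) hν hν' hne
  obtain ⟨c', hc', hvol'⟩ := exists_volume_inter_ge (x := x) (ν := ν') (ν' := ν') hν' hν'
    (fun h0 => by
      have : ν' = 0 := by simpa [← two_smul ℝ ν'] using h0
      simp [this] at hν')
  have hpos (r : ℝ) (hr : 0 < r) : 0 < volume.real (halfBall x r ν') := by
    rw [measureReal_def]
    refine ENNReal.toReal_pos ((isOpen_halfBall r).measure_pos _ ?_).ne'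
      (volume_halfBall_lt_top r).ne
    refine ⟨x + (r / 2) • ν', ?_, ?_⟩
    · rw [Metric.mem_ball, dist_eq_norm, add_sub_cancel_left, norm_smul, hν',
        Real.norm_of_nonneg (by positivity)]
      linarith
    · rw [add_sub_cancel_left, inner_smul_left, real_inner_self_eq_norm_sq, hν']
      simpa using hr
  have hsmall : ∀ᶠ r in 𝓝[>] (0 : ℝ), ⨍ y in halfBall x r ν', ‖u y - a‖ < c * (δ / 2) :=
    ha.eventually (gt_mem_nhds (by positivity))
  obtain ⟨r, hr1, hr2, hr3⟩ := (hsmall.and ((h.eventually_halfBall (half_pos hδ0)).and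
    self_mem_nhdsWithin)).exists
  have hr : 0 < r := hr3
  have hint : IntegrableOn (fun y => ‖u y - a‖) (halfBall x r ν') := by
    refine IntegrableOn.mono_set ?_ ((halfBall_subset_ball r).trans Metric.ball_subset_closedBall)
    exact ((hu.sub (continuous_const (y := a)).locallyIntegrable).integrableOn_isCompact
      (isCompact_closedBall x r)).norm
  have h1 : volume.real (halfBall x r ν ∩ halfBall x r ν') * (δ / 2) ≤
      ∫ y in halfBall x r ν ∩ halfBall x r ν', ‖u y - a‖ := by
    refine setIntegral_ge_of_const_le (c := δ / 2)
      ((isOpen_halfBall r).measurableSet.inter (isOpen_halfBall r).measurableSet)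
      ((measure_mono inter_subset_left).trans_lt (volume_halfBall_lt_top r)).ne ?_
      (hint.mono_set inter_subset_right)
    intro y hy
    have h2 := hr2 y hy.1
    have h3 := norm_sub_le_norm_sub_add_norm_sub a (u y) a₀
    rw [norm_sub_rev a (u y)] at h3
    linarith
  have h2 : ∫ y in halfBall x r ν ∩ halfBall x r ν', ‖u y - a‖ ≤
      ∫ y in halfBall x r ν', ‖u y - a‖ :=
    setIntegral_mono_set hint (Eventually.of_forall fun _ => norm_nonneg _)
      inter_subset_right.eventuallyLE
  rw [setAverage_eq, smul_eq_mul, inv_mul_lt_iff₀ (hpos r hr)] at hr1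
  have h3 := mul_le_mul_of_nonneg_right (hvol r hr) (half_pos hδ0).le
  linarith

lemma add_self_ne_zero_of_norm (hν : ‖ν‖ = 1) : ν + ν ≠ 0 := fun h0 => by
  have : ν = 0 := by simpa [← two_smul ℝ ν] using h0
  simp [this] at hν

/-- At a continuity point both one-sided traces would have to be `u x`, whereas a jump point
requires `a ≠ b`. -/
lemma not_isJumpPoint_of_continuousAt (hu : LocallyIntegrable u) (hx : ContinuousAt u x) :
    ¬ IsJumpPoint u x a b ν := by
  intro h
  have hs (n : E N) : SidedLimit u x n (u x) := hx.tendsto.mono_left nhdsWithin_le_nhds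
  have hν : ‖-ν‖ = 1 := by rw [norm_neg, h.unit]
  exact h.ne (((hs ν).eq_of_tendsto_average hu h.unit h.unit (add_self_ne_zero_of_norm h.unit)
    h.lim_pos).trans ((hs (-ν)).eq_of_tendsto_average hu hν hν (add_self_ne_zero_of_norm hν)
    h.lim_neg).symm)

lemma isJumpPoint_of_sidedLimit (hν : ‖ν‖ = 1) (hne : a ≠ b) (ha : SidedLimit u x ν a)
    (hb : SidedLimit u x (-ν) b) : IsJumpPoint u x a b ν :=
  ⟨hne, hν, ha.tendsto_average, hb.tendsto_average⟩

/-- The triple at a jump point with one-sided limits is unique up to a change of orientation. -/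
lemma IsJumpPoint.eq_or_eq (h : IsJumpPoint u x a b ν') (hu : LocallyIntegrable u)
    (hν : ‖ν‖ = 1) (hne : a₀ ≠ b₀) (ha : SidedLimit u x ν a₀) (hb : SidedLimit u x (-ν) b₀) :
    (a = a₀ ∧ b = b₀ ∧ ν' = ν) ∨ (a = b₀ ∧ b = a₀ ∧ ν' = -ν) := by
  have hmν : ‖-ν‖ = 1 := by rw [norm_neg, hν]
  have hmν' : ‖-ν'‖ = 1 := by rw [norm_neg, h.unit]
  by_cases h1 : ν' = ν
  · subst h1
    exact Or.inl ⟨ha.eq_of_tendsto_average hu hν hν (add_self_ne_zero_of_norm hν) h.lim_pos,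
      hb.eq_of_tendsto_average hu hmν hmν (add_self_ne_zero_of_norm hmν) h.lim_neg, rfl⟩
  by_cases h2 : ν' = -ν
  · subst h2
    refine Or.inr ⟨hb.eq_of_tendsto_average hu hmν hmν (add_self_ne_zero_of_norm hmν) h.lim_pos,
      ha.eq_of_tendsto_average hu hν hmν' ?_ h.lim_neg, rfl⟩
    rw [neg_neg]
    exact add_self_ne_zero_of_norm hν
  -- A third direction `ν'` is opposite to neither `ν` nor `-ν`, so its trace `a` would equal both
  -- `a₀` and `b₀`.
  exfalso
  apply hne
  rw [← ha.eq_of_tendsto_average hu hν h.unit (fun h0 => h2 (eq_neg_of_add_eq_zero_right h0))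
    h.lim_pos]
  refine hb.eq_of_tendsto_average hu hmν h.unit (fun h0 => h1 ?_) h.lim_pos
  rw [add_comm, ← sub_eq_add_neg] at h0
  exact sub_eq_zero.1 h0

lemma jumpTriple_spec (h : ∃ a b ν, IsJumpPoint u x a b ν) :
    IsJumpPoint u x (jumpTriple u x).1 (jumpTriple u x).2.1 (jumpTriple u x).2.2 := by
  obtain ⟨a, b, ν, h⟩ := h
  have h' : ∃ p : E d × E d × E N, IsJumpPoint u x p.1 p.2.1 p.2.2 := ⟨(a, b, ν), h⟩
  rw [jumpTriple, dif_pos h']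
  exact h'.choose_spec

/-- `jumpTriple` is an arbitrary choice, so only its class up to orientation can be computed. -/
lemma jump_eq_or_eq (hu : LocallyIntegrable u) (hν : ‖ν‖ = 1) (hne : a₀ ≠ b₀)
    (ha : SidedLimit u x ν a₀) (hb : SidedLimit u x (-ν) b₀) :
    (jump u x = a₀ - b₀ ∧ jumpNormal u x = ν) ∨ (jump u x = -(a₀ - b₀) ∧ jumpNormal u x = -ν) := by
  rcases (jumpTriple_spec ⟨_, _, _, isJumpPoint_of_sidedLimit hν hne ha hb⟩).eq_or_eq hu hν hne
    ha hb with ⟨h1, h2, h3⟩ | ⟨h1, h2, h3⟩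
  · exact Or.inl ⟨by rw [jump, h1, h2], h3⟩
  · exact Or.inr ⟨by rw [jump, h1, h2, neg_sub], h3⟩

end Jump

/-! ### Approximate gradients and traces -/

section Gradient

variable {d N : ℕ} {Ω : Set (E N)} {u : E N → E d} {G G' : E N → Matrix (Fin d) (Fin N) ℝ}

lemma IsSBVWithGradient.grad (h : IsSBVWithGradient Ω u G) :
    IsSBVWithGradient Ω u (grad Ω u) := by
  have h' : IsSBV Ω u := ⟨G, h⟩
  rw [StructuredDeformation.grad, dif_pos h']
  exact h'.choose_spec

/-- The density of the absolutely continuous part of `Du` is unique. -/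
lemma IsSBVWithGradient.ae_eq (hΩ : IsOpen Ω) (h : IsSBVWithGradient Ω u G)
    (h' : IsSBVWithGradient Ω u G') : ∀ᵐ x ∂volume.restrict Ω, G x = G' x := by
  have key : ∀ i j, ∀ᵐ x ∂volume.restrict Ω, G x i j = G' x i j := by
    intro i j
    rw [ae_restrict_iff' hΩ.measurableSet]
    have h1 := hΩ.ae_eq_zero_of_integral_contDiff_smul_eq_zero (μ := volume)
      (f := fun x => G x i j - G' x i j)
      (((h.integrable_grad i j).sub (h'.integrable_grad i j)).locallyIntegrableOn) ?_
    · filter_upwards [h1] with x hx hxΩ using sub_eq_zero.1 (hx hxΩ)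
    · intro φ hφ hc hs
      -- The jump part of the derivative depends on `u` alone, so it cancels and `G - G'` integrates
      -- to zero against every test function.
      have e := (h.deriv_eq φ hφ hc hs i j).symm.trans (h'.deriv_eq φ hφ hc hs i j)
      simp only [derivPairing, neg_inj, add_left_inj] at e
      have hb : ∃ C, ∀ x, ‖φ x‖ ≤ C := hφ.continuous.bounded_above_of_compact_support hc
      obtain ⟨C, hC⟩ := hb
      have hi (G : E N → Matrix (Fin d) (Fin N) ℝ) (hG : IntegrableOn (fun x => G x i j) Ω) :
          IntegrableOn (fun x => φ x * G x i j) Ω := by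
        have hG' : Integrable (fun x => G x i j) (volume.restrict Ω) := hG
        exact hG'.bdd_mul hφ.continuous.aestronglyMeasurable (Eventually.of_forall hC)
      have hz : ∀ x, x ∉ Ω → φ x • (G x i j - G' x i j) = 0 := by
        intro x hx
        rw [image_eq_zero_of_notMem_tsupport (fun hx' => hx (hs hx')), zero_smul]
      rw [← setIntegral_eq_integral_of_forall_compl_eq_zero hz]
      simp only [smul_eq_mul, mul_sub]
      rw [integral_sub (hi G (h.integrable_grad i j)) (hi G' (h'.integrable_grad i j)), e, sub_self]
  have hall : ∀ᵐ x ∂volume.restrict Ω, ∀ i j, G x i j = G' x i j :=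
    ae_all_iff.2 fun i => ae_all_iff.2 fun j => key i j
  filter_upwards [hall] with x hx
  ext i j
  exact hx i j

end Gradient

/-! ### The competitors -/

/-- The functional `x ↦ (A x)ᵢ`. -/
noncomputable def linRow {d N : ℕ} (A : Matrix (Fin d) (Fin N) ℝ) (i : Fin d) : E N →L[ℝ] ℝ :=
  innerSL ℝ (WithLp.toLp 2 (A i))

lemma linMap_apply {d N : ℕ} (A : Matrix (Fin d) (Fin N) ℝ) (x : E N) (i : Fin d) :
    linMap A x i = linRow A i x := by
  simp [linMap, linRow, Matrix.mulVec, dotProduct, PiLp.inner_apply, mul_comm]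

lemma linRow_coordDir {d N : ℕ} (A : Matrix (Fin d) (Fin N) ℝ) (i : Fin d) (j : Fin N) :
    linRow A i (coordDir j) = A i j := by
  simp [linRow, EuclideanSpace.inner_single_right]

lemma continuous_linMap {d N : ℕ} (A : Matrix (Fin d) (Fin N) ℝ) : Continuous (linMap A) := by
  unfold linMap
  fun_prop

lemma pderiv_mul {N : ℕ} {f g : E N → ℝ} (hf : ContDiff ℝ 1 f) (hg : ContDiff ℝ 1 g) (j : Fin N)
    (x : E N) : pderiv (fun x => f x * g x) j x = f x * pderiv g j x + g x * pderiv f j x := by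
  unfold pderiv
  rw [fderiv_fun_mul (hf.differentiable (by simp) x) (hg.differentiable (by simp) x)]
  simp

lemma continuous_pderiv {N : ℕ} {f : E N → ℝ} (hf : ContDiff ℝ 1 f) (j : Fin N) :
    Continuous (pderiv f j) :=
  (hf.continuous_fderiv (by simp)).clm_apply continuous_const

/-- The Gauss–Green formula for the affine map `x ↦ A x` on the unit cube. -/
lemma integral_cube_linMap {d N : ℕ} (A : Matrix (Fin d) (Fin N) ℝ) {φ : E N → ℝ}
    (hφ : ContDiff ℝ 1 φ) (hc : HasCompactSupport φ) (i : Fin d) (j : Fin N) :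
    ∫ x in cube N, linMap A x i * pderiv φ j x =
      - (∫ x in cube N, φ x * A i j) +
        ∫ x in frontier (cube N), φ x * linMap A x i * cubeNormal x j ∂μHE[N - 1] := by
  have hL : ContDiff ℝ 1 (linRow A i) := (linRow A i).contDiff
  have h1 := integral_cube_pderiv (hφ.mul hL) hc.mul_right j
  have hi1 : Integrable fun x => linRow A i x * pderiv φ j x :=
    (hL.continuous.mul (continuous_pderiv hφ j)).integrable_of_hasCompactSupport
      (hc.fderiv_apply (𝕜 := ℝ) _).mul_left
  have hi2 : Integrable fun x => φ x * A i j :=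
    (hφ.continuous.integrable_of_hasCompactSupport hc).mul_const _
  have hd (x : E N) : pderiv (linRow A i) j x = A i j := by
    rw [pderiv, ContinuousLinearMap.fderiv, linRow_coordDir]
  simp only [pderiv_mul hφ hL, hd] at h1
  rw [integral_add hi2.integrableOn hi1.integrableOn] at h1
  simp only [linMap_apply]
  rw [← h1]
  ring

section Competitor

variable {d N : ℕ}

/-- The affine map `x ↦ A x` with fine jumps along hyperplanes, localized by a cutoff `η`. -/
noncomputable def competitor (A : Matrix (Fin d) (Fin N) ℝ) (ξ : E d) (ν : E N) (η : E N → ℝ)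
    (τ ρ : ℝ) (x : E N) : E d :=
  linMap A x - (τ * η x * sawtooth ρ (inner ℝ ν x)) • ξ

/-- The approximate gradient of `competitor`. -/
noncomputable def competitorGrad (A : Matrix (Fin d) (Fin N) ℝ) (ξ : E d) (ν : E N)
    (η : E N → ℝ) (τ ρ : ℝ) (x : E N) : Matrix (Fin d) (Fin N) ℝ :=
  A - Matrix.of fun i j => τ * ξ i * (η x * ν j + sawtooth ρ (inner ℝ ν x) * pderiv η j x)

variable {A : Matrix (Fin d) (Fin N) ℝ} {ξ : E d} {ν : E N} {η : E N → ℝ} {τ ρ : ℝ}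

lemma competitor_apply (x : E N) (i : Fin d) : competitor A ξ ν η τ ρ x i =
    linMap A x i - τ * ξ i * (sawtooth ρ (inner ℝ ν x) * η x) := by
  simp only [competitor, PiLp.sub_apply, PiLp.smul_apply, smul_eq_mul]
  ring

lemma measurable_sawtooth_inner : Measurable fun x : E N => sawtooth ρ (inner ℝ ν x) :=
  (measurable_sawtooth ρ).comp (Continuous.measurable (by fun_prop))

lemma integrable_sawtooth_mul (hρ : 0 < ρ) {g : E N → ℝ} (hg : Integrable g) :
    Integrable fun x => sawtooth ρ (inner ℝ ν x) * g x :=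
  hg.bdd_mul (c := 1 / ρ) measurable_sawtooth_inner.aestronglyMeasurable
    (Eventually.of_forall fun x => by
      rw [Real.norm_of_nonneg (sawtooth_nonneg hρ _)]; exact sawtooth_le hρ _)

lemma locallyIntegrable_competitor (hρ : 0 < ρ) (hη : Continuous η) (hc : HasCompactSupport η) :
    LocallyIntegrable (competitor A ξ ν η τ ρ) := by
  have h1 : Integrable fun x => (τ * η x * sawtooth ρ (inner ℝ ν x)) • ξ := by
    have := ((integrable_sawtooth_mul (ν := ν) hρ
      (hη.integrable_of_hasCompactSupport hc)).const_mul τ).smul_const ξ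
    refine this.congr (Eventually.of_forall fun x => ?_)
    simp only [mul_assoc, mul_comm]
  exact (continuous_linMap A).locallyIntegrable.sub h1.locallyIntegrable

/-- Off the planes the sawtooth is continuous. On a plane where `η` vanishes, the bounded sawtooth
is multiplied by a function tending to zero. -/
lemma continuousAt_competitor (hη : Continuous η) {x : E N}
    (hx : x ∉ sawtoothPlanes ν ρ ∨ η x = 0) (hρ : 0 < ρ) :
    ContinuousAt (competitor A ξ ν η τ ρ) x := by
  have key : ContinuousAt (fun x => τ * η x * sawtooth ρ (inner ℝ ν x)) x := by
    rcases hx with hx | hx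
    · have h1 : ContinuousAt (fun x : E N => Int.fract (ρ * inner ℝ ν x)) x := by
        refine ContinuousAt.comp (g := Int.fract) (continuousAt_fract ?_)
          (Continuous.continuousAt (by fun_prop))
        exact fun h => hx ⟨_, h⟩
      exact (continuousAt_const.mul hη.continuousAt).mul (h1.div_const ρ)
    · have h0 : Tendsto (fun x => τ * η x) (𝓝 x) (𝓝 0) := by
        rw [show (0 : ℝ) = τ * η x by rw [hx, mul_zero]]
        exact (hη.tendsto x).const_mul τ
      have h1 := bdd_le_mul_tendsto_zero (f := fun x : E N => sawtooth ρ (inner ℝ ν x))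
        (Eventually.of_forall fun _ => sawtooth_nonneg hρ _)
        (Eventually.of_forall fun _ => sawtooth_le hρ _) h0
      simp only [ContinuousAt, hx, mul_zero, zero_mul]
      simpa only [mul_comm] using h1
  exact (continuous_linMap A).continuousAt.sub (key.smul continuousAt_const)

lemma sidedLimit_competitor (hη : Continuous η) {x : E N} {n : E N} {s : ℝ}
    (hs : Tendsto (fun y : E N => Int.fract (ρ * inner ℝ ν y))
      (𝓝[{y | 0 < inner ℝ (y - x) n}] x) (𝓝 s)) :
    SidedLimit (competitor A ξ ν η τ ρ) x n (linMap A x - (τ * η x * (s / ρ)) • ξ) := by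
  have h1 := ((continuous_linMap A).tendsto x).mono_left
    (nhdsWithin_le_nhds (s := {y | 0 < inner ℝ (y - x) n}))
  have h2 := ((continuous_const.mul hη : Continuous fun x => τ * η x).tendsto x).mono_left
    (nhdsWithin_le_nhds (s := {y | 0 < inner ℝ (y - x) n}))
  exact h1.sub ((h2.mul (hs.div_const ρ)).smul_const ξ)

/-- The fractional part has right limit `0` at integers, so the correction vanishes on the side of
`ν`. -/
lemma sidedLimit_competitor_pos (hη : Continuous η) {x : E N} (hρ : 0 < ρ)
    (hx : x ∈ sawtoothPlanes ν ρ) :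
    SidedLimit (competitor A ξ ν η τ ρ) x ν (linMap A x) := by
  obtain ⟨k, hk⟩ := hx
  have hcont : Tendsto (fun y : E N => ρ * inner ℝ ν y) (𝓝 x) (𝓝 (k : ℝ)) := by
    rw [← hk]; exact Continuous.tendsto (by fun_prop) x
  have := sidedLimit_competitor (A := A) (ξ := ξ) (ν := ν) (τ := τ) (n := ν) (s := 0) (x := x) hη
    ((tendsto_fract_right' k).comp (tendsto_nhdsWithin_iff.2
      ⟨hcont.mono_left nhdsWithin_le_nhds, by
        filter_upwards [self_mem_nhdsWithin] with y hy
        replace hy : 0 < inner ℝ (y - x) ν := hy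
        rw [real_inner_comm, inner_sub_right] at hy
        rw [mem_Ici, ← hk]
        exact mul_le_mul_of_nonneg_left (by linarith) hρ.le⟩))
  simpa using this

/-- The fractional part has left limit `1` at integers, so the full height `1/ρ` of the sawtooth is
subtracted. -/
lemma sidedLimit_competitor_neg (hη : Continuous η) {x : E N} (hρ : 0 < ρ)
    (hx : x ∈ sawtoothPlanes ν ρ) :
    SidedLimit (competitor A ξ ν η τ ρ) x (-ν) (linMap A x - (τ * η x / ρ) • ξ) := by
  obtain ⟨k, hk⟩ := hx
  have hcont : Tendsto (fun y : E N => ρ * inner ℝ ν y) (𝓝 x) (𝓝 (k : ℝ)) := by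
    rw [← hk]; exact Continuous.tendsto (by fun_prop) x
  have := sidedLimit_competitor (A := A) (ξ := ξ) (ν := ν) (τ := τ) (n := -ν) (s := 1) (x := x)
    hη ((tendsto_fract_left' k).comp (tendsto_nhdsWithin_iff.2
      ⟨hcont.mono_left nhdsWithin_le_nhds, by
        filter_upwards [self_mem_nhdsWithin] with y hy
        replace hy : 0 < inner ℝ (y - x) (-ν) := hy
        rw [inner_neg_right, real_inner_comm, inner_sub_right] at hy
        rw [mem_Iio, ← hk]
        exact mul_lt_mul_of_pos_left (by linarith) hρ⟩))
  rwa [mul_one_div] at this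

/-- The requirements on the parameters of `competitor`. -/
structure CompetitorData {d N : ℕ} (ξ : E d) (ν : E N) (η : E N → ℝ) (τ ρ : ℝ) : Prop where
  smooth : ContDiff ℝ ∞ η
  compact : HasCompactSupport η
  support : tsupport η ⊆ cube N
  unit_normal : ‖ν‖ = 1
  unit_direction : ‖ξ‖ = 1
  amplitude_pos : 0 < τ
  frequency_pos : 0 < ρ

lemma competitor_traces_ne (hξ : ‖ξ‖ = 1) (hτ : 0 < τ) (hρ : 0 < ρ) {x : E N} (hx : η x ≠ 0) :
    linMap A x ≠ linMap A x - (τ * η x / ρ) • ξ := by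
  intro h
  have h1 : (τ * η x / ρ) • ξ = 0 := by rwa [eq_comm, sub_eq_self] at h
  rcases smul_eq_zero.1 h1 with h1 | h1
  · have : τ * η x / ρ ≠ 0 := div_ne_zero (mul_ne_zero hτ.ne' hx) hρ.ne'
    exact this h1
  · simp [h1] at hξ

/-- Elsewhere the competitor is continuous; on the planes with `η ≠ 0` the two one-sided limits
differ. The support of `η` keeps these points inside the cube. -/
lemma jumpSet_competitor (H : CompetitorData ξ ν η τ ρ) :
    jumpSet (cube N) (competitor A ξ ν η τ ρ) = sawtoothPlanes ν ρ ∩ {x | η x ≠ 0} := by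
  have ⟨hη, hc, hs, hν, hξ, hτ, hρ⟩ := H
  ext x
  constructor
  · rintro ⟨_, a, b, n, h⟩
    by_contra hx
    refine not_isJumpPoint_of_continuousAt
      (locallyIntegrable_competitor hρ hη.continuous hc)
      (continuousAt_competitor hη.continuous ?_ hρ) h
    by_contra! h'
    exact hx ⟨h'.1, h'.2⟩
  · rintro ⟨hx, hx'⟩
    exact ⟨hs (subset_tsupport _ hx'), _, _, _, isJumpPoint_of_sidedLimit hν
      (competitor_traces_ne hξ hτ hρ hx')
      (sidedLimit_competitor_pos hη.continuous hρ hx)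
      (sidedLimit_competitor_neg hη.continuous hρ hx)⟩

lemma jump_competitor (H : CompetitorData ξ ν η τ ρ) {x : E N}
    (hx : x ∈ jumpSet (cube N) (competitor A ξ ν η τ ρ)) :
    (jump (competitor A ξ ν η τ ρ) x = (τ * η x / ρ) • ξ ∧
      jumpNormal (competitor A ξ ν η τ ρ) x = ν) ∨
    (jump (competitor A ξ ν η τ ρ) x = -((τ * η x / ρ) • ξ) ∧
      jumpNormal (competitor A ξ ν η τ ρ) x = -ν) := by
  have ⟨hη, hc, hs, hν, hξ, hτ, hρ⟩ := H
  rw [jumpSet_competitor H] at hx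
  have := jump_eq_or_eq (u := competitor A ξ ν η τ ρ)
    (locallyIntegrable_competitor hρ hη.continuous hc) hν
    (competitor_traces_ne hξ hτ hρ hx.2)
    (sidedLimit_competitor_pos hη.continuous hρ hx.1)
    (sidedLimit_competitor_neg hη.continuous hρ hx.1)
  simpa only [sub_sub_cancel] using this

/-- The sign of the chosen orientation cancels in the tensor product. -/
lemma tensor_jump_competitor (H : CompetitorData ξ ν η τ ρ) {x : E N}
    (hx : x ∈ jumpSet (cube N) (competitor A ξ ν η τ ρ))
    (i : Fin d) (j : Fin N) :
    tensor (jump (competitor A ξ ν η τ ρ) x) (jumpNormal (competitor A ξ ν η τ ρ) x) i j =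
      τ / ρ * ξ i * ν j * η x := by
  have ⟨hη, hc, hs, hν, hξ, hτ, hρ⟩ := H
  rcases jump_competitor H hx with ⟨h1, h2⟩ | ⟨h1, h2⟩ <;>
  · rw [h1, h2]
    simp [tensor]
    ring

lemma measurableSet_planes_inter (hη : ContDiff ℝ ∞ η) :
    MeasurableSet (sawtoothPlanes ν ρ ∩ {x | η x ≠ 0}) :=
  (measurableSet_sawtoothPlanes ρ).inter
    (isOpen_ne_fun hη.continuous continuous_const).measurableSet

lemma setIntegral_planes_inter (φ : E N → ℝ) :
    ∫ x in sawtoothPlanes ν ρ ∩ {x | η x ≠ 0}, φ x * η x ∂μHE[N - 1] =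
      ∫ x in sawtoothPlanes ν ρ, φ x * η x ∂μHE[N - 1] :=
  (setIntegral_eq_of_subset_of_forall_sdiff_eq_zero (measurableSet_sawtoothPlanes ρ)
    inter_subset_left fun x hx => by
      have : η x = 0 := by
        by_contra h
        exact hx.2 ⟨hx.1, h⟩
      rw [this, mul_zero]).symm

lemma derivPairing_competitor (H : CompetitorData ξ ν η τ ρ)
    (G : E N → Matrix (Fin d) (Fin N) ℝ) (φ : E N → ℝ) (i : Fin d)
    (j : Fin N) :
    derivPairing (cube N) (competitor A ξ ν η τ ρ) G φ i j =
      (∫ x in cube N, φ x * G x i j) +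
        τ * ξ i * ν j * (1 / ρ * ∫ x in sawtoothPlanes ν ρ, φ x * η x ∂μHE[N - 1]) := by
  have ⟨hη, hc, hs, hν, hξ, hτ, hρ⟩ := H
  have hm : MeasurableSet (jumpSet (cube N) (competitor A ξ ν η τ ρ)) := by
    rw [jumpSet_competitor H]
    exact measurableSet_planes_inter hη
  rw [derivPairing, add_right_inj, setIntegral_congr_fun hm
    (g := fun x => τ / ρ * ξ i * ν j * (φ x * η x)), integral_const_mul,
    jumpSet_competitor H, setIntegral_planes_inter]
  · ring
  · intro x hx
    simp only [tensor_jump_competitor H hx]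
    ring

lemma integrable_competitorGrad (hη : ContDiff ℝ ∞ η) (hc : HasCompactSupport η)
    (hρ : 0 < ρ) (i : Fin d) (j : Fin N) :
    IntegrableOn (fun x => competitorGrad A ξ ν η τ ρ x i j) (cube N) := by
  have h1 : Integrable fun x => τ * ξ i * (η x * ν j + sawtooth ρ (inner ℝ ν x) * pderiv η j x) :=
    (((hη.continuous.integrable_of_hasCompactSupport hc).mul_const _).add
      (integrable_sawtooth_mul hρ ((continuous_pderiv (hη.of_le (by simp)) j
        ).integrable_of_hasCompactSupport (hc.fderiv_apply (𝕜 := ℝ) _)))).const_mul _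
  exact (integrable_const (A i j)).sub h1.integrableOn

/-- The Gauss–Green formula for the competitor. -/
lemma integral_competitor_mul_pderiv (H : CompetitorData ξ ν η τ ρ) {φ : E N → ℝ}
    (hφ : ContDiff ℝ ∞ φ)
    (hφc : HasCompactSupport φ) (i : Fin d) (j : Fin N) :
    ∫ x in cube N, competitor A ξ ν η τ ρ x i * pderiv φ j x =
      - derivPairing (cube N) (competitor A ξ ν η τ ρ) (competitorGrad A ξ ν η τ ρ) φ i j +
        ∫ x in frontier (cube N), φ x * linMap A x i * cubeNormal x j ∂μHE[N - 1] := by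
  have ⟨hη, hc, hs, hν, hξ, hτ, hρ⟩ := H
  have hφ1 : ContDiff ℝ 1 φ := hφ.of_le (by simp)
  have hη1 : ContDiff ℝ 1 η := hη.of_le (by simp)
  -- As `η` and its derivatives vanish off the cube, the sawtooth integrals over `Q` are integrals
  -- over the whole space, even when `φ` does not vanish on `∂Q`.
  have hz (x : E N) (hx : x ∉ cube N) : η x = 0 :=
    image_eq_zero_of_notMem_tsupport fun h => hx (hs h)
  have hz' (x : E N) (hx : x ∉ cube N) : pderiv η j x = 0 := by
    have : fderiv ℝ η x = 0 := by
      by_contra h0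
      exact hx (hs (support_fderiv_subset ℝ h0))
    rw [pderiv, this]; rfl
  have hI (g : E N → ℝ) (hg : Continuous g) (hgc : HasCompactSupport g) :
      Integrable fun x => sawtooth ρ (inner ℝ ν x) * g x :=
    integrable_sawtooth_mul hρ (hg.integrable_of_hasCompactSupport hgc)
  have hpη : HasCompactSupport (pderiv η j) := hc.fderiv_apply (𝕜 := ℝ) _
  have hi1 := hI (fun x => φ x * pderiv η j x)
    (hφ.continuous.mul (continuous_pderiv hη1 j)) hpη.mul_left
  have hi2 := hI (fun x => η x * pderiv φ j x)
    (hη.continuous.mul (continuous_pderiv hφ1 j)) hc.mul_right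
  have hi3 : Integrable fun x => φ x * η x :=
    (hφ.continuous.mul hη.continuous).integrable_of_hasCompactSupport hc.mul_left
  have hi4 : Integrable fun x => linMap A x i * pderiv φ j x := by
    simp only [linMap_apply]
    exact ((linRow A i).continuous.mul (continuous_pderiv hφ1 j)).integrable_of_hasCompactSupport
      (hφc.fderiv_apply (𝕜 := ℝ) _).mul_left
  have hi5 : Integrable fun x => φ x * A i j :=
    (hφ.continuous.integrable_of_hasCompactSupport hφc).mul_const _
  have hi6 : Integrable fun x => τ * ξ i *
      (ν j * (φ x * η x) + sawtooth ρ (inner ℝ ν x) * (φ x * pderiv η j x)) :=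
    ((hi3.const_mul _).add hi1).const_mul _
  -- The weight `η` is moved into the test function, so the pure sawtooth formula applies to `φ η`.
  have hsaw := integral_sawtooth_mul_fderiv hν (hφ1.mul hη1) (hc.mul_left (f := φ)) hρ (coordDir j)
  have e1 (x : E N) : fderiv ℝ (fun x => φ x * η x) x (coordDir j) =
      φ x * pderiv η j x + η x * pderiv φ j x := pderiv_mul hφ1 hη1 j x
  have e2 : inner ℝ ν (coordDir j) = ν j := by simp [EuclideanSpace.inner_single_right]
  simp only [e1, e2, mul_add] at hsaw
  rw [integral_add hi1 hi2] at hsaw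
  rw [derivPairing_competitor H]
  have hl : ∫ x in cube N, competitor A ξ ν η τ ρ x i * pderiv φ j x =
      (∫ x in cube N, linMap A x i * pderiv φ j x) -
        τ * ξ i * ∫ x, sawtooth ρ (inner ℝ ν x) * (η x * pderiv φ j x) := by
    rw [← setIntegral_eq_integral_of_forall_compl_eq_zero (s := cube N)
      (f := fun x => sawtooth ρ (inner ℝ ν x) * (η x * pderiv φ j x))
      (fun x hx => by rw [hz x hx]; ring), ← integral_const_mul,
      ← integral_sub hi4.integrableOn (hi2.const_mul _).integrableOn]
    congr 1 with x
    rw [competitor_apply]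
    ring
  have hr : ∫ x in cube N, φ x * competitorGrad A ξ ν η τ ρ x i j =
      (∫ x in cube N, φ x * A i j) - τ * ξ i * (ν j * (∫ x, φ x * η x) +
        ∫ x, sawtooth ρ (inner ℝ ν x) * (φ x * pderiv η j x)) := by
    rw [← setIntegral_eq_integral_of_forall_compl_eq_zero (s := cube N) (f := fun x => φ x * η x)
      (fun x hx => by rw [hz x hx]; ring),
      ← setIntegral_eq_integral_of_forall_compl_eq_zero (s := cube N)
        (f := fun x => sawtooth ρ (inner ℝ ν x) * (φ x * pderiv η j x))
      (fun x hx => by rw [hz' x hx]; ring), ← integral_const_mul,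
      ← integral_add (hi3.const_mul _).integrableOn hi1.integrableOn, ← integral_const_mul,
      ← integral_sub hi5.integrableOn hi6.integrableOn]
    congr 1 with x
    simp only [competitorGrad, Matrix.sub_apply, Matrix.of_apply]
    ring
  rw [hl, hr, integral_cube_linMap A hφ1 hφc]
  -- After the formula for `A x` has been inserted, what remains is `-τ ξᵢ` times the sawtooth
  -- identity.
  linear_combination (-(τ * ξ i)) * hsaw

lemma isSBVWithGradient_competitor (H : CompetitorData ξ ν η τ ρ) :
    IsSBVWithGradient (cube N) (competitor A ξ ν η τ ρ) (competitorGrad A ξ ν η τ ρ) where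
  integrable := ((locallyIntegrable_competitor H.frequency_pos H.smooth.continuous H.compact
    ).integrableOn_isCompact
    isCompact_closedCube).mono_set cube_subset_closedCube
  integrable_grad := integrable_competitorGrad H.smooth H.compact H.frequency_pos
  integrable_jump i j := by
    have ⟨hη, hc, hs, hν, hξ, hτ, hρ⟩ := H
    have hJ := jumpSet_competitor (A := A) H
    have h1 : IntegrableOn (fun x => τ / ρ * ξ i * ν j * η x)
        (jumpSet (cube N) (competitor A ξ ν η τ ρ)) μHE[N - 1] := by
      rw [hJ]
      exact IntegrableOn.mono_set
        ((integrableOn_sawtoothPlanes hν hη.continuous hc hρ).const_mul _) inter_subset_left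
    refine h1.congr_fun (fun x hx => ?_) (by rw [hJ]; exact measurableSet_planes_inter hη)
    exact (tensor_jump_competitor H hx i j).symm
  deriv_eq φ hφ hφc hφs i j := by
    -- The boundary term disappears since `φ` is supported inside the open cube.
    rw [integral_competitor_mul_pderiv H hφ hφc,
      setIntegral_eq_zero_of_forall_eq_zero,
      add_zero]
    intro x hx
    rw [isOpen_cube.frontier_eq] at hx
    rw [image_eq_zero_of_notMem_tsupport fun h => hx.2 (hφs h)]
    ring

/-- `grad` is a chosen density; uniqueness ties it to the explicit one almost everywhere. -/
lemma grad_competitor (H : CompetitorData ξ ν η τ ρ) : ∀ᵐ x ∂volume.restrict (cube N),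
    grad (cube N) (competitor A ξ ν η τ ρ) x = competitorGrad A ξ ν η τ ρ x :=
  have h := isSBVWithGradient_competitor (A := A) H
  h.grad.ae_eq isOpen_cube h

lemma hasTrace_competitor (H : CompetitorData ξ ν η τ ρ) :
    HasTrace (competitor A ξ ν η τ ρ) (linMap A) := by
  have ⟨hη, hc, hs, hν, hξ, hτ, hρ⟩ := H
  refine ⟨integrableOn_frontier_cube (continuous_linMap A), fun φ hφ hφc i j => ?_⟩
  rw [integral_competitor_mul_pderiv H hφ hφc, derivPairing, derivPairing]
  congr 3
  refine integral_congr_ae ?_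
  filter_upwards [grad_competitor (A := A) H] with x hx
  rw [hx]

/-- The integrand is the absolutely continuous part of `∂ⱼ(η s_ρ)`. The whole derivative of a
compactly supported function has integral zero, so this part balances the jumps, of size `-η/ρ`,
across the planes. -/
lemma integral_cutoff_gradient (hη : ContDiff ℝ ∞ η) (hc : HasCompactSupport η)
    (hs : tsupport η ⊆ cube N) (hν : ‖ν‖ = 1) (hρ : 0 < ρ) (j : Fin N) :
    ∫ x in cube N, (η x * ν j + sawtooth ρ (inner ℝ ν x) * pderiv η j x) =
      ν j * (1 / ρ * ∫ x in sawtoothPlanes ν ρ, η x ∂μHE[N - 1]) := by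
  have hη1 : ContDiff ℝ 1 η := hη.of_le (by simp)
  have hi1 : Integrable η := hη.continuous.integrable_of_hasCompactSupport hc
  have hi2 := integrable_sawtooth_mul (ν := ν) hρ
    ((continuous_pderiv hη1 j).integrable_of_hasCompactSupport (hc.fderiv_apply (𝕜 := ℝ) _))
  have hsaw := integral_sawtooth_mul_fderiv hν hη1 hc hρ (coordDir j)
  have e2 : inner ℝ ν (coordDir j) = ν j := by simp [EuclideanSpace.inner_single_right]
  rw [setIntegral_eq_integral_of_forall_compl_eq_zero, integral_add (hi1.mul_const _) hi2,
    integral_mul_const]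
  · rw [e2] at hsaw
    unfold pderiv
    rw [hsaw]
    ring
  · intro x hx
    have h1 : η x = 0 := image_eq_zero_of_notMem_tsupport fun h => hx (hs h)
    have h2 : fderiv ℝ η x = 0 := by
      by_contra h0
      exact hx (hs (support_fderiv_subset ℝ h0))
    simp [pderiv, h1, h2]

lemma integral_competitorGrad (hη : ContDiff ℝ ∞ η) (hc : HasCompactSupport η)
    (hs : tsupport η ⊆ cube N) (hν : ‖ν‖ = 1) (hρ : 0 < ρ) (i : Fin d) (j : Fin N) :
    ∫ x in cube N, competitorGrad A ξ ν η τ ρ x i j =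
      A i j - τ * (1 / ρ * ∫ x in sawtoothPlanes ν ρ, η x ∂μHE[N - 1]) * (ξ i * ν j) := by
  have hη1 : ContDiff ℝ 1 η := hη.of_le (by simp)
  have hi1 : Integrable η := hη.continuous.integrable_of_hasCompactSupport hc
  have hi2 := integrable_sawtooth_mul (ν := ν) hρ
    ((continuous_pderiv hη1 j).integrable_of_hasCompactSupport (hc.fderiv_apply (𝕜 := ℝ) _))
  have hi3 : Integrable fun x =>
      τ * ξ i * (η x * ν j + sawtooth ρ (inner ℝ ν x) * pderiv η j x) :=
    ((hi1.mul_const _).add hi2).const_mul _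
  simp only [competitorGrad, Matrix.sub_apply, Matrix.of_apply]
  rw [integral_sub (integrable_const _) hi3.integrableOn,
    integral_const_mul, integral_cutoff_gradient hη hc hs hν hρ]
  simp
  ring

end Competitor

/-! ### Energy estimates -/

/-- The value `1` is taken on a neighbourhood of `K`, so that derivatives of `η` vanish on `K` as
well. -/
lemma exists_cutoff {n : ℕ} {K U : Set (E n)} (hK : IsCompact K) (hU : IsOpen U) (h : K ⊆ U) :
    ∃ η : E n → ℝ, ContDiff ℝ ∞ η ∧ HasCompactSupport η ∧ tsupport η ⊆ U ∧
      (∀ᶠ x in 𝓝ˢ K, η x = 1) ∧ ∀ x, η x ∈ Icc (0 : ℝ) 1 := by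
  obtain ⟨K', hK', h1, h2⟩ := exists_compact_between hK hU h
  obtain ⟨f, hf1, hf0, hf⟩ := exists_contMDiffMap_one_nhds_of_subset_interior
    (modelWithCornersSelf ℝ (E n)) (n := (⊤ : ℕ∞)) hK.isClosed h1
  have hsub : tsupport f ⊆ K' := closure_minimal (fun x hx => by
    by_contra hx'
    exact hx (hf0 x hx')) hK'.isClosed
  exact ⟨f, f.contMDiff.contDiff, hK'.of_isClosed_subset (isClosed_tsupport _) hsub,
    hsub.trans h2, hf1, hf⟩

/-! ### Norm and pairing of rank-one matrices -/

section Norms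

variable {d N : ℕ}

lemma norm_tensor (ξ : E d) (ν : E N) : ‖tensor ξ ν‖ = ‖ξ‖ * ‖ν‖ := by
  rw [Matrix.frobenius_norm_def, EuclideanSpace.norm_eq, EuclideanSpace.norm_eq,
    ← Real.sqrt_mul (by positivity), Real.sqrt_eq_rpow, Finset.sum_mul_sum]
  congr 1
  refine Finset.sum_congr rfl fun i _ => Finset.sum_congr rfl fun j _ => ?_
  simp only [tensor, Matrix.of_apply, norm_mul, Real.rpow_two]
  ring

/-- The pairing with `ξ ⊗ ν`, linear in the matrix `l ⊗ n`, is the calibration used in the lower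
bound. -/
lemma sum_tensor_mul (ξ l : E d) (ν n : E N) :
    ∑ i, ∑ j, ξ i * ν j * tensor l n i j = inner ℝ ξ l * inner ℝ ν n := by
  simp only [PiLp.inner_apply, Finset.sum_mul_sum]
  refine Finset.sum_congr rfl fun i _ => Finset.sum_congr rfl fun j _ => ?_
  simp [tensor]
  ring

end Norms

/-! ### Lower bound by calibration -/

section LowerBound

variable {d N : ℕ} {W : Matrix (Fin d) (Fin N) ℝ → ℝ} {ψ : E d → E N → ℝ}
  {A B : Matrix (Fin d) (Fin N) ℝ}

/-- The total jump of a competitor is the difference of its boundary gradient and the average of its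
approximate gradient. -/
lemma integral_tensor_jump {u : E N → E d} (hu : u ∈ bulkCompetitors A B) (i : Fin d) (j : Fin N) :
    ∫ x in jumpSet (cube N) u, tensor (jump u x) (jumpNormal u x) i j ∂μHE[N - 1] =
      A i j - B i j := by
  obtain ⟨_, ⟨_, htr⟩, hav⟩ := hu
  obtain ⟨φ, hφ, hφc, _, hφ1, _⟩ := exists_cutoff (n := N) isCompact_closedCube isOpen_univ
    (subset_univ _)
  have h1 (x : E N) (hx : x ∈ closedCube N) : φ x = 1 := hφ1.self_of_nhdsSet x hx
  have hd (x : E N) (hx : x ∈ cube N) : pderiv φ j x = 0 := by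
    have h : φ =ᶠ[𝓝 x] fun _ => 1 :=
      hφ1.filter_mono (nhds_le_nhdsSet (cube_subset_closedCube hx))
    rw [pderiv, h.fderiv_eq]
    simp
  have hz (f : E N → ℝ) : ∫ x in cube N, f x * pderiv φ j x = 0 :=
    setIntegral_eq_zero_of_forall_eq_zero fun x hx => by rw [hd x hx, mul_zero]
  -- `u` and `A x` have the same boundary term. Since `φ` is constant on `Q` the left sides vanish,
  -- and the two interior terms agree.
  have e1 := htr φ hφ hφc i j
  have e2 := integral_cube_linMap A (hφ.of_le (by simp)) hφc i j
  rw [hz] at e1 e2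
  have e3 : derivPairing (cube N) u (grad (cube N) u) φ i j = B i j +
      ∫ x in jumpSet (cube N) u, tensor (jump u x) (jumpNormal u x) i j ∂μHE[N - 1] := by
    rw [derivPairing]
    congr 1
    · rw [← hav i j, setAverage_cube]
      exact setIntegral_congr_fun isOpen_cube.measurableSet fun x hx => by
        simp only [h1 x (cube_subset_closedCube hx), one_mul]
    · refine integral_congr_ae ?_
      -- Measurability of the set `{φ = 1}` suffices here; that of the jump set is not needed.
      have hm : MeasurableSet {x | φ x = 1} :=
        (isClosed_eq hφ.continuous continuous_const).measurableSet
      have : ∀ᵐ x ∂(μHE[N - 1] : Measure (E N)).restrict (jumpSet (cube N) u), φ x = 1 :=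
        (ae_restrict_iff hm).2 (Eventually.of_forall fun x hx => h1 x (cube_subset_closedCube hx.1))
      filter_upwards [this] with x hx
      rw [hx, one_mul]
  have e4 : ∫ x in cube N, φ x * A i j = A i j := by
    rw [setIntegral_congr_fun (g := fun _ => A i j) isOpen_cube.measurableSet fun x hx => by
      simp only [h1 x (cube_subset_closedCube hx), one_mul]]
    simp
  rw [e3] at e1
  rw [e4] at e2
  linarith

/-- Homogeneity reduces the bound to unit vectors, where it is minimality of `(ξ, ν)`. -/
lemma AdmissibleSurface.mul_norm_le (hψ : AdmissibleSurface ψ) {ξ : E d} {ν : E N}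
    (hmin : ∀ (ξ' : E d) (ν' : E N), ‖ξ'‖ = 1 → ‖ν'‖ = 1 → ψ ξ ν ≤ ψ ξ' ν') (l : E d) {n : E N}
    (hn : ‖n‖ = 1) : ψ ξ ν * ‖l‖ ≤ ψ l n := by
  rcases eq_or_ne l 0 with rfl | hl
  · simpa using hψ.nonneg 0 n hn
  · have hl' : 0 < ‖l‖ := norm_pos_iff.2 hl
    have h1 : ‖‖l‖⁻¹ • l‖ = 1 := by
      rw [norm_smul, norm_inv, norm_norm, inv_mul_cancel₀ hl'.ne']
    have h2 := hψ.homogeneous ‖l‖ (‖l‖⁻¹ • l) n hl' hn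
    rw [smul_inv_smul₀ hl'.ne'] at h2
    rw [h2, mul_comm]
    exact mul_le_mul_of_nonneg_left (hmin _ _ h1 hn) hl'.le

/-- The lower bound for the energy. -/
lemma le_energy (hψ : AdmissibleSurface ψ) {B₀ : Matrix (Fin d) (Fin N) ℝ} {ξ : E d} {ν : E N}
    (hB₀ : ∀ B, W B₀ ≤ W B) (hξ : ‖ξ‖ = 1) (hν : ‖ν‖ = 1)
    (hmin : ∀ (ξ' : E d) (ν' : E N), ‖ξ'‖ = 1 → ‖ν'‖ = 1 → ψ ξ ν ≤ ψ ξ' ν') {t : ℝ} (ht : 0 < t)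
    {u : E N → E d} (hu : u ∈ bulkCompetitors (B₀ + t • tensor ξ ν) B₀) :
    ENNReal.ofReal (W B₀) + ENNReal.ofReal (ψ (t • ξ) ν) ≤ energy W ψ (cube N) u := by
  have hm0 : 0 ≤ ψ ξ ν := hψ.nonneg ξ ν hν
  refine add_le_add ?_ ?_
  · calc ENNReal.ofReal (W B₀) = ∫⁻ _ in cube N, ENNReal.ofReal (W B₀) := by
          rw [lintegral_const, measure_univ, mul_one]
      _ ≤ _ := lintegral_mono fun x => ENNReal.ofReal_le_ofReal (hB₀ _)
  · have hJ : ∀ i j, IntegrableOn (fun x => tensor (jump u x) (jumpNormal u x) i j)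
        (jumpSet (cube N) u) μHE[N - 1] := by
      obtain ⟨G, hG⟩ := hu.1
      exact hG.integrable_jump
    set μJ := (μHE[N - 1] : Measure (E N)).restrict (jumpSet (cube N) u) with hμJ
    -- The calibration `ψ(ξ, ν) (ξ ⊗ ν) : ([u] ⊗ ν_u)`; by linearity its integral depends only on
    -- the total jump.
    set g : E N → ℝ := fun x =>
      ψ ξ ν * ∑ i, ∑ j, ξ i * ν j * tensor (jump u x) (jumpNormal u x) i j with hg
    have hJ' (i : Fin d) (j : Fin N) :
        Integrable (fun x => ξ i * ν j * tensor (jump u x) (jumpNormal u x) i j) μJ := by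
      have : Integrable (fun x => tensor (jump u x) (jumpNormal u x) i j) μJ := hJ i j
      exact this.const_mul _
    have hint : ∫ x, g x ∂μJ = ψ (t • ξ) ν := by
      rw [hψ.homogeneous t ξ ν ht hν, hg, integral_const_mul, integral_finsetSum _
        fun i _ => integrable_finsetSum _ fun j _ => hJ' i j]
      simp only [integral_finsetSum _ fun j _ => hJ' _ j, integral_const_mul]
      have e (i : Fin d) (j : Fin N) :
          ∫ x, tensor (jump u x) (jumpNormal u x) i j ∂μJ = t * tensor ξ ν i j := by
        rw [integral_tensor_jump hu i j]
        simp
      have e' : ∑ i, ∑ j, ξ i * ν j * (t * tensor ξ ν i j) = t := by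
        have := sum_tensor_mul ξ ξ ν ν
        rw [real_inner_self_eq_norm_sq, real_inner_self_eq_norm_sq, hξ, hν] at this
        calc _ = t * ∑ i, ∑ j, ξ i * ν j * tensor ξ ν i j := by
              simp only [Finset.mul_sum]
              refine Finset.sum_congr rfl fun i _ => Finset.sum_congr rfl fun j _ => by ring
          _ = t := by rw [this]; norm_num
      simp only [e, e']
      ring
    -- Cauchy–Schwarz in both factors. Where there is no jump the default triple is `0`, hence `g x
    -- = 0`, and the bound holds at every point.
    have hle (x : E N) : ‖g x‖ₑ ≤ ENNReal.ofReal (ψ (jump u x) (jumpNormal u x)) := by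
      rw [← ofReal_norm]
      by_cases hx : ∃ a b n, IsJumpPoint u x a b n
      · have hn : ‖jumpNormal u x‖ = 1 := (jumpTriple_spec hx).unit
        refine ENNReal.ofReal_le_ofReal (le_trans ?_ (hψ.mul_norm_le hmin (jump u x) hn))
        rw [hg]
        simp only [sum_tensor_mul]
        rw [norm_mul, Real.norm_of_nonneg hm0, norm_mul]
        refine mul_le_mul_of_nonneg_left ?_ hm0
        have h1 := norm_inner_le_norm (𝕜 := ℝ) ξ (jump u x)
        have h2 := norm_inner_le_norm (𝕜 := ℝ) ν (jumpNormal u x)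
        rw [hξ, one_mul] at h1
        rw [hν, hn, one_mul] at h2
        simpa using mul_le_mul h1 h2 (norm_nonneg _) (norm_nonneg _)
      · have h0 : jumpTriple u x = 0 := by
          rw [jumpTriple, dif_neg]
          rintro ⟨p, hp⟩
          exact hx ⟨_, _, _, hp⟩
        have : g x = 0 := by
          simp [hg, jump, jumpNormal, h0, tensor]
        simp [this]
    calc ENNReal.ofReal (ψ (t • ξ) ν) ≤ ‖∫ x, g x ∂μJ‖ₑ := by
          rw [hint, ← ofReal_norm]
          exact ENNReal.ofReal_le_ofReal (Real.le_norm_self _)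
      _ ≤ ∫⁻ x, ‖g x‖ₑ ∂μJ := enorm_integral_le_lintegral_enorm _
      _ ≤ _ := lintegral_mono hle

end LowerBound

/-! ### Upper bound by fine parallel jumps -/

section UpperBound

variable {d N : ℕ} {W : Matrix (Fin d) (Fin N) ℝ → ℝ} {ψ : E d → E N → ℝ}
  {A : Matrix (Fin d) (Fin N) ℝ} {ξ : E d} {ν : E N} {η : E N → ℝ} {τ ρ : ℝ}

/-- Every jump is a positive multiple of `ξ` across `ν`, up to orientation, so homogeneity and
symmetry make the surface energy linear in the jump height. -/
lemma lintegral_surface_competitor (hψ : AdmissibleSurface ψ) (H : CompetitorData ξ ν η τ ρ)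
    (h0 : ∀ x, 0 ≤ η x) :
    ∫⁻ x in jumpSet (cube N) (competitor A ξ ν η τ ρ),
      ENNReal.ofReal (ψ (jump (competitor A ξ ν η τ ρ) x)
        (jumpNormal (competitor A ξ ν η τ ρ) x)) ∂μHE[N - 1] =
    ENNReal.ofReal (ψ ξ ν * (τ * (1 / ρ * ∫ x in sawtoothPlanes ν ρ, η x ∂μHE[N - 1]))) := by
  have ⟨hη, hc, hs, hν, hξ, hτ, hρ⟩ := H
  have hJ := jumpSet_competitor (A := A) H
  have hm : MeasurableSet (jumpSet (cube N) (competitor A ξ ν η τ ρ)) := by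
    rw [hJ]; exact measurableSet_planes_inter hη
  -- The factor `1 * η x` matches `setIntegral_planes_inter` with `φ = 1`.
  have h1 : ∀ x ∈ jumpSet (cube N) (competitor A ξ ν η τ ρ),
      ENNReal.ofReal (ψ (jump (competitor A ξ ν η τ ρ) x)
        (jumpNormal (competitor A ξ ν η τ ρ) x)) =
      ENNReal.ofReal (ψ ξ ν * τ / ρ * (1 * η x)) := by
    intro x hx
    have hx' : η x ≠ 0 := by
      rw [hJ] at hx; exact hx.2
    have hpos : 0 < τ * η x / ρ := div_pos (mul_pos hτ ((h0 x).lt_of_ne' hx')) hρ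
    have e : ψ (jump (competitor A ξ ν η τ ρ) x) (jumpNormal (competitor A ξ ν η τ ρ) x) =
        ψ ((τ * η x / ρ) • ξ) ν := by
      rcases jump_competitor H hx with ⟨e1, e2⟩ | ⟨e1, e2⟩
      · rw [e1, e2]
      · rw [e1, e2, hψ.symmetric _ _ hν]
    rw [e, hψ.homogeneous _ _ _ hpos hν]
    congr 1
    ring
  have hi : IntegrableOn (fun x => ψ ξ ν * τ / ρ * (1 * η x))
      (jumpSet (cube N) (competitor A ξ ν η τ ρ)) μHE[N - 1] := by
    rw [hJ]
    simp only [one_mul]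
    exact IntegrableOn.mono_set
      ((integrableOn_sawtoothPlanes hν hη.continuous hc hρ).const_mul _) inter_subset_left
  have hψ0 : 0 ≤ ψ ξ ν := hψ.nonneg ξ ν hν
  rw [setLIntegral_congr_fun hm h1, ← ofReal_integral_eq_lintegral_ofReal hi
    (Eventually.of_forall fun x => by have := h0 x; positivity), integral_const_mul, hJ,
    setIntegral_planes_inter fun _ => 1]
  simp only [one_mul]
  congr 1
  ring

/-- Two errors: the mismatch `t - τ η` along `ξ ⊗ ν`, and the cutoff gradient, weighted by a
sawtooth of height at most `1/ρ`. -/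
lemma norm_competitorGrad_sub_le (H : CompetitorData ξ ν η τ ρ)
    {B₀ : Matrix (Fin d) (Fin N) ℝ} {t L : ℝ} (x : E N)
    (hL : ‖(WithLp.toLp 2 fun j => pderiv η j x : E N)‖ ≤ L) :
    ‖competitorGrad (B₀ + t • tensor ξ ν) ξ ν η τ ρ x - B₀‖ ≤ |t - τ * η x| + τ * (L / ρ) := by
  have ⟨hη, hc, hs, hν, hξ, hτ, hρ⟩ := H
  have e : competitorGrad (B₀ + t • tensor ξ ν) ξ ν η τ ρ x - B₀ =
      (t - τ * η x) • tensor ξ ν -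
        (τ * sawtooth ρ (inner ℝ ν x)) • tensor ξ (WithLp.toLp 2 fun j => pderiv η j x) := by
    ext i j
    simp [competitorGrad, tensor]
    ring
  rw [e]
  refine (norm_sub_le _ _).trans ?_
  rw [norm_smul, norm_smul, norm_tensor, norm_tensor, hξ, hν, Real.norm_eq_abs, norm_mul,
    Real.norm_of_nonneg hτ.le, Real.norm_of_nonneg (sawtooth_nonneg hρ _), one_mul, one_mul,
    mul_one, mul_assoc]
  refine add_le_add le_rfl (mul_le_mul_of_nonneg_left ?_ hτ.le)
  calc _ ≤ 1 / ρ * L := mul_le_mul (sawtooth_le hρ _) hL (norm_nonneg _) (by positivity)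
    _ = L / ρ := by ring

/-- Fine jumps realize the gradient `B₀` with boundary values `B₀ + t ξ ⊗ ν` almost optimally. -/
lemma exists_competitor_energy_le (hψ : AdmissibleSurface ψ) {K : ℝ≥0} (hW : LipschitzWith K W)
    {B₀ : Matrix (Fin d) (Fin N) ℝ} (hW0 : 0 ≤ W B₀) (hξ : ‖ξ‖ = 1) (hν : ‖ν‖ = 1)
    {t : ℝ} (ht : 0 < t) {δ : ℝ} (hδ : 0 < δ) (hδ' : δ ≤ 1 / 4) :
    ∃ u ∈ bulkCompetitors (B₀ + t • tensor ξ ν) B₀,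
      energy W ψ (cube N) u ≤
        ENNReal.ofReal (W B₀ + 8 * K * t * δ) + ENNReal.ofReal (ψ (t • ξ) ν) := by
  obtain ⟨C, hCQ, hC, hCδ⟩ := (isOpen_cube (N := N)).measurableSet.exists_isCompact_sdiff_lt
    (μ := volume) (by simp [volume_cube]) (ε := ENNReal.ofReal δ) (by simpa using hδ)
  obtain ⟨η, hη, hc, hs, hη1, hη01⟩ := exists_cutoff hC isOpen_cube hCQ
  have hη1' : ContDiff ℝ 1 η := hη.of_le (by simp)
  have hi : Integrable η := hη.continuous.integrable_of_hasCompactSupport hc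
  have hdef : ∫ x in cube N, (1 - η x) ≤ δ := by
    have h1 : ∫ x in cube N, (1 - η x) ≤ ∫ x in cube N, (cube N \ C).indicator 1 x := by
      refine setIntegral_mono_on ((integrable_const 1).sub hi.integrableOn)
        ((integrable_const (1 : ℝ)).indicator
          (isOpen_cube.measurableSet.diff hC.measurableSet)) isOpen_cube.measurableSet ?_
      intro x hx
      by_cases hxC : x ∈ C
      · simp [hxC, hη1.self_of_nhdsSet x hxC]
      · simp [hxC, hx, (hη01 x).1]
    refine h1.trans ?_
    rw [setIntegral_indicator (isOpen_cube.measurableSet.diff hC.measurableSet),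
      inter_eq_right.2 sdiff_subset]
    simp only [Pi.one_apply, setIntegral_const, smul_eq_mul, mul_one]
    exact (ENNReal.toReal_le_of_le_ofReal hδ.le hCδ.le)
  have hint1 : ∫ x in cube N, (1 - η x) = 1 - ∫ x in cube N, η x := by
    rw [integral_sub (integrable_const _) hi.integrableOn]
    simp
  have hηnn : 0 ≤ ∫ x in cube N, (1 - η x) :=
    integral_nonneg fun x => sub_nonneg.2 (hη01 x).2
  obtain ⟨L₁, hL₁⟩ : ∃ L, ∀ x, ‖fderiv ℝ η x ν‖ ≤ L :=
    ((hη1'.continuous_fderiv (by simp)).clm_apply continuous_const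
      ).bounded_above_of_compact_support (hc.fderiv_apply (𝕜 := ℝ) ν)
  obtain ⟨L₂, hL₂⟩ : ∃ L, ∀ x, ‖(WithLp.toLp 2 fun j => pderiv η j x : E N)‖ ≤ L := by
    refine Continuous.bounded_above_of_compact_support ?_ ?_
    · exact (PiLp.continuous_toLp 2 _).comp (continuous_pi fun j => continuous_pderiv hη1' j)
    · refine (hc.fderiv (𝕜 := ℝ)).mono fun x hx => ?_
      contrapose! hx
      simp only [Function.mem_support, not_not] at hx ⊢
      ext j
      simp [pderiv, hx]
  set L := max (max L₁ L₂) 0 with hL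
  have hL0 : 0 ≤ L := le_max_right _ _
  -- The frequency makes `L / ρ ≤ δ`; the summand `1` keeps it positive if `L = 0`.
  set ρ := L / δ + 1 with hρdef
  have hρ : 0 < ρ := by positivity
  have hLρ : L / ρ ≤ δ := by
    rw [div_le_iff₀ hρ, hρdef, mul_add, mul_div_cancel₀ _ hδ.ne']
    linarith
  set c := 1 / ρ * ∫ x in sawtoothPlanes ν ρ, η x ∂μHE[N - 1] with hcdef
  -- The sawtooth formula for `η` in direction `ν` reads `c - ∫ η = ∫ s_ρ ∂_ν η`, which is at most
  -- `L / ρ`.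
  have hcη : |c - ∫ x in cube N, η x| ≤ δ := by
    have h1 := integral_sawtooth_mul_fderiv hν hη1' hc hρ ν
    rw [real_inner_self_eq_norm_sq, hν, ← hcdef, one_pow, one_mul,
      ← setIntegral_eq_integral_of_forall_compl_eq_zero (s := cube N) (f := η)
        (fun x hx => image_eq_zero_of_notMem_tsupport fun h => hx (hs h)),
      ← setIntegral_eq_integral_of_forall_compl_eq_zero (s := cube N)] at h1
    · rw [← h1, ← Real.norm_eq_abs]
      refine (norm_setIntegral_le_of_norm_le_const (C := δ) (by simp [volume_cube])
        fun x _ => ?_).trans (by simp [measureReal_def, volume_cube])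
      rw [norm_mul, Real.norm_of_nonneg (sawtooth_nonneg hρ _)]
      calc _ ≤ 1 / ρ * L := mul_le_mul (sawtooth_le hρ _)
            ((hL₁ x).trans ((le_max_left _ _).trans (le_max_left _ _)))
            (norm_nonneg _) (by positivity)
        _ = L / ρ := by ring
        _ ≤ δ := hLρ
    · intro x hx
      have : fderiv ℝ η x = 0 := by
        by_contra h0
        exact hx (hs (support_fderiv_subset ℝ h0))
      simp [this]
  -- One `δ` comes from `1 - ∫ η`, the other from `c - ∫ η`; with `δ ≤ 1/4` this gives `c ≥ 1/2`.
  have hc1 : |c - 1| ≤ 2 * δ := by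
    rw [abs_le] at hcη ⊢
    constructor <;> linarith
  have hchalf : 1 / 2 ≤ c := by linarith [(abs_le.1 hc1).1]
  have hcpos : 0 < c := by linarith
  -- With `τ c = t` the mean gradient is exactly `B₀` and the total jump exactly `t ξ ⊗ ν`.
  set τ := t / c with hτdef
  have hτ : 0 < τ := by positivity
  have hτc : τ * c = t := div_mul_cancel₀ t hcpos.ne'
  have hτ2 : τ ≤ 2 * t := by nlinarith
  have H : CompetitorData ξ ν η τ ρ := ⟨hη, hc, hs, hν, hξ, hτ, hρ⟩
  refine ⟨competitor (B₀ + t • tensor ξ ν) ξ ν η τ ρ,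
    ⟨⟨_, isSBVWithGradient_competitor H⟩, hasTrace_competitor H, fun i j => ?_⟩,
    add_le_add ?_ ?_⟩
  · rw [setAverage_cube, integral_congr_ae (g := fun x =>
      competitorGrad (B₀ + t • tensor ξ ν) ξ ν η τ ρ x i j),
      integral_competitorGrad hη hc hs hν hρ, ← hcdef, hτc]
    · simp [tensor]
    · filter_upwards [grad_competitor (A := B₀ + t • tensor ξ ν) H] with x hx
      rw [hx]
  · have hb : ∀ᵐ x ∂volume.restrict (cube N),
        ENNReal.ofReal (W (grad (cube N) (competitor (B₀ + t • tensor ξ ν) ξ ν η τ ρ) x)) ≤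
          ENNReal.ofReal (W B₀ + K * (τ * (2 * δ) + τ * (1 - η x) + τ * δ)) := by
      filter_upwards [grad_competitor (A := B₀ + t • tensor ξ ν) H] with x hx
      rw [hx]
      refine ENNReal.ofReal_le_ofReal ?_
      have h1 := hW.dist_le_mul (competitorGrad (B₀ + t • tensor ξ ν) ξ ν η τ ρ x) B₀
      rw [dist_eq_norm, dist_eq_norm, Real.norm_eq_abs] at h1
      have h2 := norm_competitorGrad_sub_le H (B₀ := B₀) (t := t) x
        ((hL₂ x).trans ((le_max_right L₁ _).trans (le_max_left _ 0)))
      have h3 : |t - τ * η x| ≤ τ * (2 * δ) + τ * (1 - η x) := by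
        have : t - τ * η x = τ * ((c - 1) + (1 - η x)) := by rw [← hτc]; ring
        rw [this, abs_mul, abs_of_pos hτ, ← mul_add]
        refine mul_le_mul_of_nonneg_left ((abs_add_le _ _).trans (add_le_add hc1 ?_)) hτ.le
        rw [abs_of_nonneg (sub_nonneg.2 (hη01 x).2)]
      have h4 : τ * (L / ρ) ≤ τ * δ := mul_le_mul_of_nonneg_left hLρ hτ.le
      have h5 := mul_le_mul_of_nonneg_left (h2.trans (add_le_add h3 h4)) K.coe_nonneg
      linarith [(abs_le.1 h1).2]
    have hiI : IntegrableOn (fun x => W B₀ + K * (τ * (2 * δ) + τ * (1 - η x) + τ * δ)) (cube N) :=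
      (integrable_const _).add (((((integrable_const _).add
        (((integrable_const 1).sub hi.integrableOn).const_mul _))).add
          (integrable_const _)).const_mul _)
    refine (lintegral_mono_ae hb).trans ?_
    rw [← ofReal_integral_eq_lintegral_ofReal hiI (Eventually.of_forall fun x => by
      have := sub_nonneg.2 (hη01 x).2
      show 0 ≤ W B₀ + K * (τ * (2 * δ) + τ * (1 - η x) + τ * δ)
      positivity)]
    refine ENNReal.ofReal_le_ofReal ?_
    have hi1 : IntegrableOn (fun x => τ * (1 - η x)) (cube N) :=
      ((integrable_const 1).sub hi.integrableOn).const_mul _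
    have hi2 : IntegrableOn (fun x => τ * (2 * δ) + τ * (1 - η x)) (cube N) :=
      (integrable_const _).add hi1
    have hi3 : IntegrableOn (fun x => τ * (2 * δ) + τ * (1 - η x) + τ * δ) (cube N) :=
      hi2.add (integrable_const _)
    rw [integral_add (integrable_const _) (hi3.const_mul _), integral_const_mul (K : ℝ),
      integral_add hi2 (integrable_const _), integral_add (integrable_const _) hi1,
      integral_const_mul τ fun x => 1 - η x]
    simp only [integral_const, probReal_univ, one_smul]
    -- The errors sum to at most `4 τ δ`, and `τ ≤ 2 t`.
    have h1 : τ * (2 * δ) + τ * (∫ x in cube N, (1 - η x)) + τ * δ ≤ 8 * t * δ := by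
      have := mul_le_mul_of_nonneg_left hdef hτ.le
      have := mul_le_mul_of_nonneg_right hτ2 hδ.le
      linarith
    have := mul_le_mul_of_nonneg_left h1 K.coe_nonneg
    linarith
  · rw [lintegral_surface_competitor hψ H fun x => (hη01 x).1, ← hcdef, hτc,
      hψ.homogeneous t ξ ν ht hν, mul_comm]

end UpperBound

/-- The relaxed bulk density along the ray `B₀ + t ξ ⊗ ν`. -/
theorem relaxedBulk_eq {d N : ℕ} {W : Matrix (Fin d) (Fin N) ℝ → ℝ} {ψ : E d → E N → ℝ}
    (hW : AdmissibleBulk W) (hψ : AdmissibleSurface ψ) {B₀ : Matrix (Fin d) (Fin N) ℝ} {ξ : E d}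
    {ν : E N} (hB₀ : ∀ B, W B₀ ≤ W B) (hξ : ‖ξ‖ = 1) (hν : ‖ν‖ = 1)
    (hmin : ∀ (ξ' : E d) (ν' : E N), ‖ξ'‖ = 1 → ‖ν'‖ = 1 → ψ ξ ν ≤ ψ ξ' ν') {t : ℝ} (ht : 0 < t) :
    relaxedBulk W ψ (B₀ + t • tensor ξ ν) B₀ = ENNReal.ofReal (W B₀ + ψ (t • ξ) ν) := by
  rw [ENNReal.ofReal_add (hW.nonneg _) (hψ.nonneg _ _ hν)]
  refine le_antisymm ?_ (le_iInf₂ fun u hu => le_energy hψ hB₀ hξ hν hmin ht hu)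
  obtain ⟨K, hK⟩ := hW.lipschitz
  -- The bulk error is linear in `δ`, so letting `δ` tend to `0` from above closes the gap.
  have hev : ∀ᶠ δ in 𝓝[>] (0 : ℝ), relaxedBulk W ψ (B₀ + t • tensor ξ ν) B₀ ≤
      ENNReal.ofReal (W B₀ + 8 * K * t * δ) + ENNReal.ofReal (ψ (t • ξ) ν) := by
    filter_upwards [self_mem_nhdsWithin, mem_nhdsWithin_of_mem_nhds (Iio_mem_nhds
      (show (0 : ℝ) < 1 / 4 by norm_num))] with δ hδ hδ'
    obtain ⟨u, hu, hE⟩ := exists_competitor_energy_le hψ hK (hW.nonneg B₀) hξ hν ht hδ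
      (le_of_lt hδ')
    exact (iInf₂_le u hu).trans hE
  refine ge_of_tendsto ?_ hev
  have h1 : Tendsto (fun δ : ℝ => W B₀ + 8 * K * t * δ) (𝓝[>] 0) (𝓝 (W B₀)) := by
    have : Continuous fun δ : ℝ => W B₀ + 8 * K * t * δ := by fun_prop
    simpa using (this.tendsto 0).mono_left nhdsWithin_le_nhds
  exact (ENNReal.tendsto_ofReal h1).add tendsto_const_nhds

/-! ### The Frobenius inner product -/

section Frobenius

variable {d N : ℕ}

/-- A matrix as a vector of a Euclidean space. -/
noncomputable def vec (A : Matrix (Fin d) (Fin N) ℝ) : EuclideanSpace ℝ (Fin d × Fin N) :=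
  WithLp.toLp 2 fun p => A p.1 p.2

lemma norm_vec (A : Matrix (Fin d) (Fin N) ℝ) : ‖vec A‖ = ‖A‖ := by
  rw [Matrix.frobenius_norm_def, EuclideanSpace.norm_eq, Real.sqrt_eq_rpow,
    Fintype.sum_prod_type]
  simp [vec]

lemma vec_add (A B : Matrix (Fin d) (Fin N) ℝ) : vec (A + B) = vec A + vec B := rfl

lemma vec_smul (t : ℝ) (A : Matrix (Fin d) (Fin N) ℝ) : vec (t • A) = t • vec A := rfl

lemma inner_vec (A B : Matrix (Fin d) (Fin N) ℝ) :
    inner ℝ (vec A) (vec B) = ∑ i, ∑ j, A i j * B i j := by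
  rw [PiLp.inner_apply, Fintype.sum_prod_type]
  simp [vec, mul_comm]

lemma norm_le_sum_abs (A : Matrix (Fin d) (Fin N) ℝ) : ‖A‖ ≤ ∑ i, ∑ j, |A i j| := by
  have h : vec A = ∑ p : Fin d × Fin N, A p.1 p.2 • EuclideanSpace.single p (1 : ℝ) := by
    ext q
    simp [vec, Finset.sum_apply, Pi.single_apply]
  rw [← norm_vec, h]
  refine (norm_sum_le _ _).trans ?_
  rw [Fintype.sum_prod_type]
  simp [norm_smul]

/-- This is Cauchy–Schwarz for `(A, 1)` and `(X, 1)`. Divided by `√(‖A‖² + 1)`, it is the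
supporting-plane inequality at `A` for the convex function `X ↦ √(‖X‖² + 1)`. -/
lemma sqrt_tangent (A X : Matrix (Fin d) (Fin N) ℝ) :
    inner ℝ (vec A) (vec X) + 1 ≤ √(‖A‖ ^ 2 + 1) * √(‖X‖ ^ 2 + 1) := by
  have h1 := real_inner_le_norm (vec A) (vec X)
  rw [norm_vec, norm_vec] at h1
  rw [← Real.sqrt_mul (by positivity)]
  refine Real.le_sqrt_of_sq_le ?_
  have h2 := neg_le_of_abs_le (abs_real_inner_le_norm (vec A) (vec X))
  rw [norm_vec, norm_vec] at h2
  have h3 : (inner ℝ (vec A) (vec X)) ^ 2 ≤ (‖A‖ * ‖X‖) ^ 2 := sq_le_sq' (by linarith) h1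
  nlinarith [sq_nonneg (‖A‖ - ‖X‖)]

end Frobenius

/-! ### Quasiconvexity-convexity of `H₀` -/

section Quasiconvex

variable {d N : ℕ}

/-- Integration by parts for Lipschitz functions against a cutoff equal to `1` near the closed cube:
its derivative vanishes wherever `f` does not. -/
lemma integral_cube_fderiv_eq_zero {K : ℝ≥0} {f : E N → ℝ} (hf : LipschitzWith K f)
    (h0 : ∀ x, x ∉ cube N → f x = 0) (e : E N) : ∫ x in cube N, fderiv ℝ f x e = 0 := by
  obtain ⟨φ, hφ, hφc, _, hφ1, _⟩ := exists_cutoff (n := N) isCompact_closedCube isOpen_univ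
    (subset_univ _)
  obtain ⟨D, hD⟩ := ContDiff.lipschitzWith_of_hasCompactSupport hφc hφ (by simp)
  have h1 := hf.integral_lineDeriv_mul_eq (μ := volume) hD hφc e
  have h2 : ∀ x, lineDeriv ℝ φ x (-e) * f x = 0 := by
    intro x
    by_cases hx : x ∈ cube N
    · have h : φ =ᶠ[𝓝 x] fun _ => 1 :=
        hφ1.filter_mono (nhds_le_nhdsSet (cube_subset_closedCube hx))
      have h3 : HasFDerivAt φ (0 : E N →L[ℝ] ℝ) x :=
        (hasFDerivAt_const (1 : ℝ) x).congr_of_eventuallyEq h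
      rw [(h3.hasLineDerivAt (-e)).lineDeriv]
      simp
    · rw [h0 x hx, mul_zero]
  simp only [h2, integral_zero] at h1
  -- Off the closed cube `f` vanishes locally; the boundary of the cube is a null set.
  have h5 : ∀ᵐ x : E N, x ∉ cube N → lineDeriv ℝ f x e * φ x = 0 := by
    filter_upwards [closedCube_ae_eq_cube.mem_iff] with x hx hxQ
    have hx' : x ∉ closedCube N := fun h => hxQ (hx.1 h)
    have h : f =ᶠ[𝓝 x] fun _ => 0 := by
      filter_upwards [isClosed_closedCube.isOpen_compl.mem_nhds hx'] with y hy
      exact h0 y fun h => hy (cube_subset_closedCube h)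
    have h3 : HasFDerivAt f (0 : E N →L[ℝ] ℝ) x :=
      (hasFDerivAt_const (0 : ℝ) x).congr_of_eventuallyEq h
    rw [(h3.hasLineDerivAt e).lineDeriv]
    simp
  rw [← setIntegral_eq_integral_of_ae_compl_eq_zero h5] at h1
  refine Eq.trans (integral_congr_ae ?_) h1
  filter_upwards [ae_restrict_mem isOpen_cube.measurableSet,
    ae_restrict_of_ae hf.ae_differentiableAt] with x hx hd
  rw [hφ1.self_of_nhdsSet x (cube_subset_closedCube hx), mul_one, hd.lineDeriv_eq_fderiv]

lemma integrableOn_gradMatrix {K : ℝ≥0} {v : E N → E d} (hv : LipschitzWith K v) (i : Fin d)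
    (j : Fin N) : IntegrableOn (fun x => gradMatrix v x i j) (cube N) := by
  have hm : Measurable fun x => gradMatrix v x i j :=
    (EuclideanSpace.proj (𝕜 := ℝ) i).continuous.measurable.comp
      (measurable_fderiv_apply_const ℝ v (coordDir j))
  refine Measure.integrableOn_of_bounded (M := K) (by simp [volume_cube])
    hm.aestronglyMeasurable (Eventually.of_forall fun x => ?_)
  calc ‖gradMatrix v x i j‖ ≤ ‖fderiv ℝ v x (coordDir j)‖ := PiLp.norm_apply_le _ i
    _ ≤ ‖fderiv ℝ v x‖ * ‖coordDir j‖ := ContinuousLinearMap.le_opNorm _ _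
    _ ≤ K := by
      rw [norm_coordDir, mul_one]
      exact norm_fderiv_le_of_lipschitz ℝ hv

lemma integral_gradMatrix {K : ℝ≥0} {v : E N → E d} (hv : LipschitzWith K v)
    (h0 : ∀ x, x ∉ cube N → v x = 0) (i : Fin d) (j : Fin N) :
    ∫ x in cube N, gradMatrix v x i j = 0 := by
  have hL : LipschitzWith (1 * K) fun x => v x i :=
    (LipschitzWith.of_dist_le_mul fun y z => by
      simpa [dist_eq_norm] using PiLp.norm_apply_le (y - z) i :
        LipschitzWith 1 fun y : E d => y i).comp hv
  rw [← integral_cube_fderiv_eq_zero hL (fun x hx => by rw [h0 x hx]; rfl) (coordDir j)]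
  refine integral_congr_ae (ae_restrict_of_ae ?_)
  filter_upwards [hv.ae_differentiableAt] with x hx
  have h2 : HasFDerivAt (fun x => v x i)
      ((EuclideanSpace.proj i : E d →L[ℝ] ℝ).comp (fderiv ℝ v x)) x :=
    (EuclideanSpace.proj i : E d →L[ℝ] ℝ).hasFDerivAt.comp x hx.hasFDerivAt
  rw [h2.fderiv]
  rfl

lemma integrableOn_norm_matrix {X : E N → Matrix (Fin d) (Fin N) ℝ}
    (hX : ∀ i j, IntegrableOn (fun x => X x i j) (cube N)) :
    IntegrableOn (fun x => ‖X x‖) (cube N) := by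
  have hm : AEStronglyMeasurable (fun x => ‖X x‖) (volume.restrict (cube N)) := by
    have : AEMeasurable (fun x => vec (X x)) (volume.restrict (cube N)) :=
      (PiLp.continuous_toLp 2 _).measurable.comp_aemeasurable
        (aemeasurable_pi_lambda _ fun p => (hX p.1 p.2).aestronglyMeasurable.aemeasurable)
    simp only [← norm_vec]
    exact this.norm.aestronglyMeasurable
  have hs : Integrable (fun x => ∑ i, ∑ j, |X x i j|) (volume.restrict (cube N)) :=
    integrable_finsetSum _ fun i _ => integrable_finsetSum _ fun j _ => (hX i j).abs
  exact hs.mono' hm (Eventually.of_forall fun x => by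
    rw [norm_norm]; exact norm_le_sum_abs _)

/-- A linear functional does not see a perturbation of mean zero. -/
lemma integral_inner_vec {X : E N → Matrix (Fin d) (Fin N) ℝ}
    (hX : ∀ i j, IntegrableOn (fun x => X x i j) (cube N)) (h0 : ∀ i j, ∫ x in cube N, X x i j = 0)
    (A : Matrix (Fin d) (Fin N) ℝ) :
    IntegrableOn (fun x => inner ℝ (vec A) (vec (A + X x))) (cube N) ∧
      ∫ x in cube N, inner ℝ (vec A) (vec (A + X x)) = ‖A‖ ^ 2 := by
  have hs (i : Fin d) (j : Fin N) :
      Integrable (fun x => A i j * X x i j) (volume.restrict (cube N)) := by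
    have : Integrable (fun x => X x i j) (volume.restrict (cube N)) := hX i j
    exact this.const_mul _
  have hs' : Integrable (fun x => ∑ i, ∑ j, A i j * X x i j) (volume.restrict (cube N)) :=
    integrable_finsetSum _ fun i _ => integrable_finsetSum _ fun j _ => hs i j
  simp only [vec_add, inner_add_right, real_inner_self_eq_norm_sq, norm_vec]
  simp only [inner_vec]
  refine ⟨(integrable_const _).add hs', ?_⟩
  rw [integral_add (integrable_const _) hs', integral_finsetSum _
    fun i _ => integrable_finsetSum _ fun j _ => hs i j]
  simp only [integral_finsetSum _ fun j _ => hs _ j, integral_const_mul, h0]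
  simp

/-- Both `∇v` and `w` have mean zero on `Q`, so integrating the supporting-plane inequalities of the
two convex summands gives the bound. -/
theorem quasiconvexConvex_H₀ : QuasiconvexConvex (H₀ (d := d) (N := N)) := by
  rintro A B v w ⟨K, hv⟩ hv0 hw hw0
  have hG := integrableOn_gradMatrix hv
  have hG0 := integral_gradMatrix hv hv0
  have hwI (i : Fin d) (j : Fin N) : IntegrableOn (fun x => w x i j) (cube N) :=
    (hw i j).integrable le_top
  have hw0' (i : Fin d) (j : Fin N) : ∫ x in cube N, w x i j = 0 := by
    rw [← setAverage_cube]; exact hw0 i j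
  have hX : IntegrableOn (fun x => ‖A + gradMatrix v x‖) (cube N) :=
    integrableOn_norm_matrix fun i j => (integrable_const (A i j)).add (hG i j)
  have hY : IntegrableOn (fun x => ‖B + w x‖) (cube N) :=
    integrableOn_norm_matrix fun i j => (integrable_const (B i j)).add (hwI i j)
  have hX' : IntegrableOn (fun x => √(‖A + gradMatrix v x‖ ^ 2 + 1)) (cube N) := by
    refine Integrable.mono' (hX.add (integrable_const (1 : ℝ))) ?_
      (Eventually.of_forall fun x => ?_)
    · exact (Real.continuous_sqrt.comp (by fun_prop : Continuous fun s : ℝ => s ^ 2 + 1)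
        ).comp_aestronglyMeasurable hX.aestronglyMeasurable
    · rw [Real.norm_of_nonneg (Real.sqrt_nonneg _)]
      refine Real.sqrt_le_iff.2 ⟨add_nonneg (norm_nonneg _) zero_le_one, ?_⟩
      show _ ≤ (‖A + gradMatrix v x‖ + 1) ^ 2
      nlinarith [norm_nonneg (A + gradMatrix v x)]
  refine ⟨hX'.add hY, ?_⟩
  rw [setAverage_cube]
  unfold H₀
  rw [integral_add hX' hY]
  refine add_le_add ?_ ?_
  · obtain ⟨hI, hI'⟩ := integral_inner_vec hG hG0 A
    have ha : 0 < √(‖A‖ ^ 2 + 1) := Real.sqrt_pos.2 (by positivity)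
    have h1 : ∫ x in cube N, (inner ℝ (vec A) (vec (A + gradMatrix v x)) + 1) ≤
        ∫ x in cube N, √(‖A‖ ^ 2 + 1) * √(‖A + gradMatrix v x‖ ^ 2 + 1) :=
      integral_mono (Integrable.add hI (integrable_const _)) (hX'.const_mul _)
        fun x => sqrt_tangent _ _
    rw [integral_add hI (integrable_const _), hI', integral_const_mul] at h1
    simp only [integral_const, probReal_univ, one_smul] at h1
    refine le_of_mul_le_mul_left (le_trans (le_of_eq ?_) h1) ha
    rw [Real.mul_self_sqrt (by positivity)]
  · obtain ⟨hI, hI'⟩ := integral_inner_vec hwI hw0' B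
    -- At `B = 0` there is no division by `‖B‖`, and nonnegativity suffices.
    rcases (norm_nonneg B).eq_or_lt with hB | hB
    · rw [← hB]
      exact integral_nonneg fun x => norm_nonneg _
    · have h1 : ∫ x in cube N, inner ℝ (vec B) (vec (B + w x)) ≤
          ∫ x in cube N, ‖B‖ * ‖B + w x‖ :=
        integral_mono hI (hY.const_mul _) fun x => by
          rw [← norm_vec B, ← norm_vec (B + w x)]
          exact real_inner_le_norm _ _
      rw [hI', integral_const_mul] at h1
      exact le_of_mul_le_mul_left (by rwa [← sq]) hB

/-- `H₀` is not affine along rays in a rank-one direction. -/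
lemma H₀_not_affine {ξ : E d} {ν : E N} (hξ : ‖ξ‖ = 1) (hν : ‖ν‖ = 1)
    (B₀ : Matrix (Fin d) (Fin N) ℝ) :
    ¬ ∃ a b : ℝ, ∀ t : ℝ, 0 < t → H₀ (B₀ + t • tensor ξ ν) B₀ = a * t + b := by
  rintro ⟨a, b, h⟩
  set β := inner ℝ (vec B₀) (vec (tensor ξ ν)) with hβ
  have hT : ‖tensor ξ ν‖ = 1 := by rw [norm_tensor, hξ, hν, one_mul]
  have hβ' : β ^ 2 ≤ ‖B₀‖ ^ 2 := by
    have := abs_real_inner_le_norm (vec B₀) (vec (tensor ξ ν))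
    rw [norm_vec, norm_vec, hT, mul_one] at this
    exact sq_le_sq' (neg_le_of_abs_le this) (le_of_abs_le this)
  have key (t : ℝ) (ht : 0 < t) :
      ‖B₀‖ ^ 2 + 2 * t * β + t ^ 2 + 1 = (a * t + (b - ‖B₀‖)) ^ 2 := by
    have h1 : √(‖B₀ + t • tensor ξ ν‖ ^ 2 + 1) = a * t + (b - ‖B₀‖) := by
      have := h t ht
      rw [H₀] at this
      linarith
    rw [← h1, Real.sq_sqrt (by positivity), ← norm_vec (B₀ + _), vec_add, norm_add_sq_real,
      vec_smul, inner_smul_right, norm_smul, norm_vec, norm_vec, hT, Real.norm_of_nonneg ht.le]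
    ring
  -- Three values determine a quadratic polynomial. Comparing coefficients gives `a² = 1`, `a q = β`
  -- and `q² = ‖B₀‖² + 1`, hence `β² = ‖B₀‖² + 1`, contrary to `β² ≤ ‖B₀‖²`.
  have k1 := key 1 (by norm_num)
  have k2 := key 2 (by norm_num)
  have k3 := key 3 (by norm_num)
  set q := b - ‖B₀‖
  have ha : a ^ 2 = 1 := by nlinarith
  have hb : a * q = β := by nlinarith
  have hc : q ^ 2 = ‖B₀‖ ^ 2 + 1 := by nlinarith
  have : β ^ 2 = ‖B₀‖ ^ 2 + 1 := by rw [← hb, mul_pow, ha, hc, one_mul]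
  linarith

end Quasiconvex

/-! ### Minimizers -/

section Minimizers

variable {d N : ℕ}

/-- The lower growth bound makes the continuous function `W` coercive. -/
lemma AdmissibleBulk.exists_min {W : Matrix (Fin d) (Fin N) ℝ → ℝ} (hW : AdmissibleBulk W) :
    ∃ B₀ : Matrix (Fin d) (Fin N) ℝ, ∀ B, W B₀ ≤ W B := by
  obtain ⟨K, hK⟩ := hW.lipschitz
  obtain ⟨c, C, hc, _, hg⟩ := hW.growth
  have : ProperSpace (Matrix (Fin d) (Fin N) ℝ) := FiniteDimensional.proper ℝ _
  refine hK.continuous.exists_forall_le (tendsto_atTop_mono (fun A => (hg A).1) ?_)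
  exact (tendsto_norm_cocompact_atTop).const_mul_atTop hc

/-- The product of the two spheres is compact, and it is nonempty because `d` and `N` are positive.
-/
lemma AdmissibleSurface.exists_min (hd : 1 ≤ d) (hN : 1 ≤ N) {ψ : E d → E N → ℝ}
    (hψ : AdmissibleSurface ψ) : ∃ (ξ : E d) (ν : E N), ‖ξ‖ = 1 ∧ ‖ν‖ = 1 ∧
      ∀ (ξ' : E d) (ν' : E N), ‖ξ'‖ = 1 → ‖ν'‖ = 1 → ψ ξ ν ≤ ψ ξ' ν' := by
  have hne : (Metric.sphere (0 : E d) 1 ×ˢ Metric.sphere (0 : E N) 1).Nonempty :=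
    ⟨(coordDir ⟨0, hd⟩, coordDir ⟨0, hN⟩), by simp⟩
  obtain ⟨p, hp, hmin⟩ := ((isCompact_sphere (0 : E d) 1).prod
    (isCompact_sphere (0 : E N) 1)).exists_isMinOn hne
      (hψ.continuousOn.mono (prod_mono_left (subset_univ _)))
  refine ⟨p.1, p.2, by simpa using hp.1, by simpa using hp.2, fun ξ' ν' h1 h2 => ?_⟩
  exact hmin (a := (ξ', ν')) ⟨by simpa using h1, by simpa using h2⟩

end Minimizers

end StructuredDeformation

/-! ### The main theorem -/

open StructuredDeformation in
theorem proposition6p3 {d N : ℕ} (hd : 1 ≤ d) (hN : 1 ≤ N)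
    (W : Matrix (Fin d) (Fin N) ℝ → ℝ) (ψ : E d → E N → ℝ)
    (hW : AdmissibleBulk W) (hψ : AdmissibleSurface ψ) :
    -- minimizers of `W`, and of `ψ` on pairs of unit vectors, exist
    (∃ B₀ : Matrix (Fin d) (Fin N) ℝ, ∀ B, W B₀ ≤ W B) ∧
    (∃ (ξ : E d) (ν : E N), ‖ξ‖ = 1 ∧ ‖ν‖ = 1 ∧
      ∀ (ξ' : E d) (ν' : E N), ‖ξ'‖ = 1 → ‖ν'‖ = 1 → ψ ξ ν ≤ ψ ξ' ν') ∧
    -- the formula for `H` at any such minimizers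
    (∀ (B₀ : Matrix (Fin d) (Fin N) ℝ) (ξ : E d) (ν : E N),
      (∀ B, W B₀ ≤ W B) → ‖ξ‖ = 1 → ‖ν‖ = 1 →
      (∀ (ξ' : E d) (ν' : E N), ‖ξ'‖ = 1 → ‖ν'‖ = 1 → ψ ξ ν ≤ ψ ξ' ν') →
      (∀ t : ℝ, 0 < t →
        relaxedBulk W ψ (B₀ + t • tensor ξ ν) B₀ = ENNReal.ofReal (W B₀ + ψ (t • ξ) ν)) ∧
      -- whereas `H₀` is not affine along this ray
      ¬ ∃ a b : ℝ, ∀ t : ℝ, 0 < t → H₀ (B₀ + t • tensor ξ ν) B₀ = a * t + b) ∧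
    -- hence `H` is not the quasiconvex-convex function `H₀`
    QuasiconvexConvex (H₀ (d := d) (N := N)) ∧
    relaxedBulk W ψ ≠ fun A B => ENNReal.ofReal (H₀ A B) := by
  refine ⟨hW.exists_min, hψ.exists_min hd hN, fun B₀ ξ ν hB₀ hξ hν hmin =>
    ⟨fun t ht => relaxedBulk_eq hW hψ hB₀ hξ hν hmin ht, H₀_not_affine hξ hν B₀⟩,
    quasiconvexConvex_H₀, fun heq => ?_⟩
  obtain ⟨B₀, hB₀⟩ := hW.exists_min
  obtain ⟨ξ, ν, hξ, hν, hmin⟩ := hψ.exists_min hd hN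
  -- If `H` were `H₀`, then `H₀` would be affine on the ray, with slope `ψ ξ ν` and intercept `W
  -- B₀`.
  refine H₀_not_affine hξ hν B₀ ⟨ψ ξ ν, W B₀, fun t ht => ?_⟩
  have h1 := relaxedBulk_eq hW hψ hB₀ hξ hν hmin ht
  rw [heq, hψ.homogeneous t ξ ν ht hν] at h1
  have h2 : 0 ≤ H₀ (B₀ + t • tensor ξ ν) B₀ := add_nonneg (Real.sqrt_nonneg _) (norm_nonneg _)
  have h3 : 0 ≤ W B₀ + t * ψ ξ ν :=
    add_nonneg (hW.nonneg _) (mul_nonneg ht.le (hψ.nonneg ξ ν hν))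
  rw [(ENNReal.ofReal_eq_ofReal_iff h2 h3).1 h1]
  ring
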